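/- All channels are discrete memoryless channels $W(y\mid x)$. For a channel with a $q$-ary input alphabet $\mathcal X$ let $I(W)$ be the mutual information, in bits, between a uniformly distributed input and the output, and let $$Z(W)=\frac1{q(q-1)}\sum_{x\ne x'}Z_{x,x'}(W),\qquad Z_{x,x'}(W)=\sum_y\sqrt{W(y\mid x)\,W(y\mid x')}.$$ *Splitting.* For a mapping $g(v_1,\dots,v_r)=(x_1,\dots,x_\ell)$, defined for $v_j\in A_j$ and with values in $\mathcal X^\ell$, and a channel $W$ with input alphabet $\mathcal X$, the $i$-th split channel has input $v_i$ and output $(y_1^\ell,v_1^{i-1})$: $$W^{(i)}(y_1^\ell,v_1^{i-1}\mid v_i)=\Big(\prod_{j\ne i}|A_j|\Big)^{-1}\sum_{v_{i+1},\dots,v_r}\ \prod_{k=1}^{\ell}W\big(y_k\mid g(v)_k\big).$$ *Homogeneous kernels.* A kernel of dimension $\ell$ over $\{0,1\}^b$ is a bijection $g$ of $(\{0,1\}^b)^\ell$ onto itself. Its partial distance $D^{(i)}_{x,x'}$ is the least Hamming distance between $g(v_1^{i-1},x,w)$ and $g(v_1^{i-1},x',\tilde w)$ over all $v_1^{i-1},w,\tilde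 w$. Let $D^{(i)}_{\min}=\min_{x\neq x'}D^{(i)}_{x,x'}$ and $D^{(i)}_{\max}=\max_{x,x'}D^{(i)}_{x,x'}$. The lower and upper bounds on the exponent of $g$ are $$E_1(g)=\frac1\ell\sum_{i=1}^\ell\log_\ell D^{(i)}_{\min},\qquad E_2(g)=\frac1\ell\sum_{i=1}^\ell\log_\ell D^{(i)}_{\max}.$$ The kernel $g$ is polarizing if for every channel $\tilde W$ with input alphabet $\{0,1\}^b$ the process $\tilde W_0=\tilde W$, $\tilde W_{n+1}=\tilde W_n^{(B_n)}$, with $B_n$ i.i.d. uniform on $\{1,\dots,\ell\}$, satisfies $\Pr\big(I(\tilde W_n)/b\in(\delta,1-\delta)\big)\to0$ for all $\delta\in(0,1/2)$. *Mixed kernel.* Let $m_1,\dots,m_r\ge1$ with $\sum_i m_i=\ell$, and let $\mathcal B=\{i: m_i\ge2\}$ be the set of glued inputs, assumed non-empty. Let $g_1:\prod_{i=1}^r\{0,1\}^{m_i}\to\{0,1\}^\ell$ be the kernel induced by a binary code decomposition: starting from $\{0,1\}^\ell$, the $i$-th symbol $v_i\in\{0,1\}^{m_i}$ selects one of $2^{m_i}$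 equally sized disjoint parts of the current code, and $g_1(v_1,\dots,v_r)$ is the single word that is left at the end. For each $i\in\mathcal B$ let $g_{i+1}$ be a kernel of dimension $\ell$ over $\{0,1\}^{m_i}$. Put $$E_1(g)=\min_{i\in\mathcal B}E_1(g_{i+1}),\qquad E_2(g)=\max_{i\in\mathcal B}E_2(g_{i+1}).$$ *Tree process.* Let $\mathcal W$ be a binary-input channel and $W_0=\mathcal W$. As long as $W_n$ has a one-bit input, $W_{n+1}=W_n^{(i)}$ is formed with $g_1$, where $i$ is chosen with probability $m_i/\ell$. Once a glued input $i\in\mathcal B$ has been chosen, all later steps use $g_{i+1}$, with index uniform on $\{1,\dots,\ell\}$. All choices are independent. Let $Z_n=Z(W_n)$. **Proposition.** If $g_{i+1}$ is polarizing for every $i\in\mathcal B$ and $Z(\mathcal W)\ne0$, then $$\lim_{n\to\infty}\Pr\big(Z_n\le2^{-\ell^{\beta n}}\big)=I(\mathcal W)\quad\text{for all } 0\le\beta<E_1(g),$$ $$\lim_{n\to\infty}\Pr\big(Z_n\ge2^{-\ell^{\beta n}}\big)=1\quad\text{for all } \beta>E_2(g).$$ -/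

import Mathlib

open Filter Topology MeasureTheory
open scoped ENNReal

noncomputable section

/-! ### Discrete memoryless channels -/

/-- Transition probabilities `prob x y = W(y | x)` from the input alphabet `X` to a discrete
output alphabet. -/
structure Transition (X : Type) where
  /-- the output alphabet -/
  Out : Type
  /-- `prob x y = W(y | x)` -/
  prob : X → Out → ℝ

namespace Transition

variable {X : Type}

/-- `C` is a channel: for every input, the outputs carry a probability distribution. -/
def IsChannel (C : Transition X) : Prop :=
  (∀ x y, 0 ≤ C.prob x y) ∧ ∀ x, HasSum (C.prob x) 1

/-- The Bhattacharyya coefficient `Z_{x,x'}(W) = ∑_y √(W(y|x) W(y|x'))` of two input symbols. -/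
def bhattPair (C : Transition X) (x x' : X) : ℝ :=
  ∑' y, Real.sqrt (C.prob x y * C.prob x' y)

/-- The Bhattacharyya parameter `Z(W)` of a `q`-ary channel: the average of `Z_{x,x'}(W)` over
the `q (q - 1)` ordered pairs of distinct input symbols. -/
def bhatt [Fintype X] [DecidableEq X] (C : Transition X) : ℝ :=
  ((Fintype.card X : ℝ) * ((Fintype.card X : ℝ) - 1))⁻¹ *
    ∑ p : X × X, if p.1 ≠ p.2 then C.bhattPair p.1 p.2 else 0

/-- The symmetric capacity `I(W)`, in bits: the mutual information between the input and the
output of the channel when the input is uniformly distributed. -/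
def info [Fintype X] (C : Transition X) : ℝ :=
  ∑ x : X, ∑' y, (Fintype.card X : ℝ)⁻¹ * C.prob x y *
    Real.logb 2 (C.prob x y / ((Fintype.card X : ℝ)⁻¹ * ∑ x', C.prob x' y))

/-- Channel splitting. The input `v = (v_0, …, v_{r-1})` of the mapping `g` is sent as the word
`g v` over `ℓ` independent uses of `C`. The `i`-th split channel has input `v_i` and output
`(y, (v_j)_{j < i})`, the later inputs being uniformly distributed:
`W^{(i)}(y, v_{<i} | v_i) = (∏_{j ≠ i} |A_j|)⁻¹ ∑_{v_{>i}} ∏_k W(y_k | g(v)_k)`. -/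
def split {r ℓ : ℕ} {A : Fin r → Type} [∀ j, Fintype (A j)] [∀ j, DecidableEq (A j)]
    (g : (∀ j, A j) → Fin ℓ → X) (C : Transition X) (i : Fin r) : Transition (A i) where
  Out := (Fin ℓ → C.Out) × (∀ j : {j : Fin r // j < i}, A j)
  prob := fun x o =>
    (∏ j ∈ Finset.univ.erase i, (Fintype.card (A j) : ℝ))⁻¹ *
      ∑ v : (∀ j, A j),
        if v i = x ∧ ∀ j : {j : Fin r // j < i}, v j = o.2 j then
          ∏ k, C.prob (g v k) (o.1 k)
        else 0

end Transition

/-! ### Homogeneous kernels over the alphabet of `b`-bit symbols -/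

/-- The symbols made of `b` bits. -/
abbrev Symb (b : ℕ) : Type := Fin b → Bool

/-- A kernel of dimension `ℓ` over the alphabet `{0,1}^b`. -/
abbrev SymKernel (ℓ b : ℕ) : Type := (Fin ℓ → Symb b) ≃ (Fin ℓ → Symb b)

namespace SymKernel

variable {ℓ b : ℕ}

/-- The partial distance `D^{(i)}_{x,x'}`: the least Hamming distance of two output words whose
inputs agree before position `i`, and are `x` and `x'` respectively at position `i`. -/
def partialDist (g : SymKernel ℓ b) (i : Fin ℓ) (x x' : Symb b) : ℕ :=
  sInf {d | ∃ v v' : Fin ℓ → Symb b, (∀ j, j < i → v j = v' j) ∧ v i = x ∧ v' i = x' ∧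
    d = hammingDist (g v) (g v')}

/-- `D^{(i)}_min`, the minimum of `D^{(i)}_{x,x'}` over `x ≠ x'`. -/
def partialDistMin (g : SymKernel ℓ b) (i : Fin ℓ) : ℕ :=
  sInf {d | ∃ x x' : Symb b, x ≠ x' ∧ d = g.partialDist i x x'}

/-- `D^{(i)}_max`, the maximum of `D^{(i)}_{x,x'}` over `x, x'`. -/
def partialDistMax (g : SymKernel ℓ b) (i : Fin ℓ) : ℕ :=
  Finset.univ.sup fun p : Symb b × Symb b => g.partialDist i p.1 p.2

/-- The lower bound `E_1(g) = (1/ℓ) ∑_i log_ℓ D^{(i)}_min` on the exponent of the kernel. -/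
def lowerExponent (g : SymKernel ℓ b) : ℝ :=
  (ℓ : ℝ)⁻¹ * ∑ i, Real.logb ℓ (g.partialDistMin i)

/-- The upper bound `E_2(g) = (1/ℓ) ∑_i log_ℓ D^{(i)}_max` on the exponent of the kernel. -/
def upperExponent (g : SymKernel ℓ b) : ℝ :=
  (ℓ : ℝ)⁻¹ * ∑ i, Real.logb ℓ (g.partialDistMax i)

/-- The channel tree process of the construction that uses only the kernel `g`, along the path
`ω` of branch choices: `W_0 = C` and `W_{n+1} = W_n^{(ω_n)}`. -/
def treeChannel (g : SymKernel ℓ b) (C : Transition (Symb b)) (ω : ℕ → Fin ℓ) :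
    ℕ → Transition (Symb b)
  | 0 => C
  | n + 1 => Transition.split (A := fun _ : Fin ℓ => Symb b) g (treeChannel g C ω n) (ω n)

end SymKernel

/-- The law of an i.i.d. sequence of uniformly distributed branches in `{0, …, ℓ - 1}`. -/
def uniformBranches (ℓ : ℕ) [NeZero ℓ] : Measure (ℕ → Fin ℓ) :=
  Measure.infinitePi fun _ : ℕ => (PMF.uniformOfFintype (Fin ℓ)).toMeasure

/-- The kernel `g` is polarizing: for every channel `C` with input alphabet `{0,1}^b`, the
normalized capacities in the construction based only on `g` polarize,
`Pr(I(W_n)/b ∈ (δ, 1 - δ)) → 0` for all `δ ∈ (0, 1/2)`. -/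
def SymKernel.IsPolarizing {ℓ b : ℕ} [NeZero ℓ] (g : SymKernel ℓ b) : Prop :=
  ∀ C : Transition (Symb b), C.IsChannel → ∀ δ : ℝ, 0 < δ → δ < 1 / 2 →
    Tendsto (fun n : ℕ => (uniformBranches ℓ).real
      {ω | (g.treeChannel C ω n).info / b ∈ Set.Ioo δ (1 - δ)}) atTop (𝓝 0)

/-! ### Binary code decompositions -/

/-- A decomposition of the code `{0,1}^ℓ` into nested sub-codes, where the `i`-th symbol of
`m i` bits selects one of `2 ^ (m i)` parts of equal size. `T i v` is the sub-code at level `i`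
that is selected by the symbols `v_j`, `j < i`. At the last level the sub-codes are single
words. -/
structure CodeDecomposition (ℓ : ℕ) {r : ℕ} (m : Fin r → ℕ) where
  /-- the sub-code of level `i` with the labels `v_j`, `j < i` -/
  T : Fin (r + 1) → (∀ j, Symb (m j)) → Finset (Fin ℓ → Bool)
  /-- `T i v` depends only on the first `i` labels -/
  congr : ∀ i v v', (∀ j : Fin r, j.castSucc < i → v j = v' j) → T i v = T i v'
  /-- the sub-code of level zero is the whole space -/
  zero : ∀ v, T 0 v = Finset.univ
  /-- the parts cover the sub-code -/
  cover : ∀ (i : Fin r) v,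
    (Finset.univ.biUnion fun b : Symb (m i) => T i.succ (Function.update v i b)) = T i.castSucc v
  /-- the parts are disjoint -/
  disjoint : ∀ (i : Fin r) v (b b' : Symb (m i)), b ≠ b' →
    Disjoint (T i.succ (Function.update v i b)) (T i.succ (Function.update v i b'))
  /-- the parts have equal size -/
  card : ∀ (i : Fin r) v (b : Symb (m i)),
    (T i.succ (Function.update v i b)).card * 2 ^ m i = (T i.castSucc v).card
  /-- the sub-codes of the last level are single words -/
  last : ∀ v, (T (Fin.last r) v).card = 1

/-- The transformation induced by a code decomposition: `g v` is the word that is selected by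
the labels `v`. -/
def CodeDecomposition.kernel {ℓ r : ℕ} {m : Fin r → ℕ} (D : CodeDecomposition ℓ m)
    (v : ∀ j, Symb (m j)) : Fin ℓ → Bool :=
  (Finset.card_eq_one.mp (D.last v)).choose

/-! ### General mixed kernels -/

/-- A general mixed kernel of dimension `ℓ`: a binary kernel induced by a code decomposition
with `r` inputs, the `i`-th of which consists of `m i` bits (glued together if `m i ≥ 2`), and
for each glued input a kernel of dimension `ℓ` over the alphabet `{0,1}^(m i)`. There is at least
one glued input. -/
structure MixedKernel where
  /-- the dimension -/
  ℓ : ℕ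
  /-- the number of inputs of the binary kernel -/
  r : ℕ
  /-- the number of bits of each input -/
  m : Fin r → ℕ
  m_pos : ∀ i, 1 ≤ m i
  sum_m : ∑ i, m i = ℓ
  exists_glued : ∃ i, 2 ≤ m i
  /-- the code decomposition that induces the binary kernel -/
  decomposition : CodeDecomposition ℓ m
  /-- the auxiliary kernels of the glued inputs -/
  aux : ∀ i : {i : Fin r // 2 ≤ m i}, SymKernel ℓ (m i)

namespace MixedKernel

/-- The set of indices of the glued inputs. -/
abbrev Glued (K : MixedKernel) : Type := {i : Fin K.r // 2 ≤ K.m i}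

instance (K : MixedKernel) : Nonempty K.Glued :=
  let ⟨i, hi⟩ := K.exists_glued
  ⟨⟨i, hi⟩⟩

instance (K : MixedKernel) : NeZero K.ℓ := ⟨by
  obtain ⟨i, hi⟩ := K.exists_glued
  have h : K.m i ≤ ∑ j, K.m j := Finset.single_le_sum (fun _ _ => Nat.zero_le _)
    (Finset.mem_univ i)
  have := K.sum_m
  omega⟩

/-- `E_1(g)`, the minimum of the lower exponent bounds of the auxiliary kernels. -/
def lowerExponent (K : MixedKernel) : ℝ :=
  Finset.univ.inf' Finset.univ_nonempty fun i : K.Glued => (K.aux i).lowerExponent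

/-- `E_2(g)`, the maximum of the upper exponent bounds of the auxiliary kernels. -/
def upperExponent (K : MixedKernel) : ℝ :=
  Finset.univ.sup' Finset.univ_nonempty fun i : K.Glued => (K.aux i).upperExponent

/-- A node of the channel tree: a binary-input channel, or a channel whose input is a symbol of
`m i` glued bits that descends from the glued input `i` of the binary kernel. -/
inductive Node (K : MixedKernel) : Type 1
  | single (C : Transition Bool) : Node K
  | glued (i : K.Glued) (C : Transition (Symb (K.m i))) : Node K

/-- The Bhattacharyya parameter of the channel at a node. -/
def Node.bhatt {K : MixedKernel} : Node K → ℝ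
  | .single C => C.bhatt
  | .glued _ C => C.bhatt

/-- The descendant number `i` of a single-bit channel under the binary kernel. A one-bit symbol
is identified with its bit. -/
def splitSingle (K : MixedKernel) (C : Transition Bool) (i : Fin K.r) : Node K :=
  if h : 2 ≤ K.m i then
    .glued ⟨i, h⟩ (Transition.split K.decomposition.kernel C i)
  else
    .single
      { Out := (Transition.split K.decomposition.kernel C i).Out
        prob := fun x => (Transition.split K.decomposition.kernel C i).prob fun _ => x }

/-- The law on the inputs of the binary kernel that gives the input `i` the probability
`m i / ℓ`. -/
def inputLaw (K : MixedKernel) : PMF (Fin K.r) :=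
  PMF.ofFintype (fun i => (K.m i : ℝ≥0∞) / (K.ℓ : ℝ≥0∞)) (by
    simp only [div_eq_mul_inv]
    rw [← Finset.sum_mul, ← Nat.cast_sum, K.sum_m]
    exact ENNReal.mul_inv_cancel (by exact_mod_cast NeZero.ne K.ℓ) (ENNReal.natCast_ne_top _))

/-- The sample space of the tree process: a sequence `B^{(1)}` of inputs of the binary kernel,
and for each auxiliary kernel a sequence of inputs of that kernel. -/
abbrev Sample (K : MixedKernel) : Type := (ℕ → Fin K.r) × (K.Glued → ℕ → Fin K.ℓ)

/-- The sequences are independent, and each of them is i.i.d., with the law `m i / ℓ` for the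
binary kernel and with the uniform law for the auxiliary kernels. -/
def prob (K : MixedKernel) : Measure K.Sample :=
  (Measure.infinitePi fun _ : ℕ => K.inputLaw.toMeasure).prod
    (Measure.pi fun _ : K.Glued => uniformBranches K.ℓ)

/-- The channel tree process `W_0 = C`, `W_{n+1} = W_n^{(B_n)}`. While the channel has a one-bit
input, the binary kernel and the sequence `B^{(1)}` are used; once it descends from the glued
input `i`, the auxiliary kernel of `i` and its sequence are used. -/
def treeChannel (K : MixedKernel) (C : Transition Bool) (ω : K.Sample) : ℕ → Node K
  | 0 => .single C
  | n + 1 =>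
    match treeChannel K C ω n with
    | .single C' => K.splitSingle C' (ω.1 n)
    | .glued i C' =>
      .glued i (Transition.split (A := fun _ : Fin K.ℓ => Symb (K.m i)) (K.aux i) C' (ω.2 i n))

end MixedKernel

end

/-! Each step draws a fresh independent branch, so the law of `W_n` is a finite weighted sum over
paths of length `n`. `measureReal_treeChannel` rewrites the probabilities as `chance`; what remains
is the analysis of weighted trees and of a single splitting step.

A splitting step is controlled by two facts. By the chain rule (`sum_info_split`) the information
per input bit is a martingale. For a kernel over `b`-bit symbols, `Z` becomes at most `2^c *
Z^D_min` (`exists_bhatt_splitAt_le`), and a common lower bound `2^(-a)` on all pair coefficients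
becomes `2^(-(D_max * a + c))` (`exists_splitAt_mem_bhattAbove`). Up to additive constants the
exponent is thus multiplied by at least `D_min` and at most `D_max`, and a law of large numbers in
Chernoff form gives growth at the rates `E_1` and `E_2`. For decay the additive loss must first be
outgrown: in `eventually_chance_lt_le` a small power of `Z` contracts in the mean for a fraction of
the time, and multiplication takes over afterwards.

For a polarizing kernel `I/b` ends near 0 or near 1, and the martingale property makes the chance of
the latter tend to the initial `I/b`. Information near the maximum forces small `Z`, from which the
fast decay starts; information near 0 forces `Z > 1/2`. This is `tendsto_treeChance_bhatt_le`. The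
converse rate, `tendsto_treeChance_le_bhatt`, uses only positivity of the pair coefficients.

In the mixed construction the one-bit phase survives `T` steps with probability at most `ρ^T`, and
after it the process is that of a single auxiliary kernel (`chance_glued`). So
`tendsto_chance_of_glued` stops at a large fixed `T`, takes the single-kernel limit at every glued
node and averages: the mean of the normalized information is still `I(W)`, and for the second claim
the limit is the constant 1. The steps spent before gluing are the reason for the shift `T + n` in
the single-kernel results. -/

noncomputable section

/-! ### Averages over the branches of a tree -/

section IterMean

variable {S ι : Type*} [Fintype ι]

/-- The mean of `f` over the `n`-th generation of the tree that grows from `s`, when the branch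
`i` is chosen with probability `w i`. -/
def iterMean (w : ι → ℝ) (step : S → ι → S) : ℕ → (S → ℝ) → S → ℝ
  | 0, f, s => f s
  | n + 1, f, s => ∑ i, w i * iterMean w step n f (step s i)

/-- The probability that the `n`-th generation descendant of `s` lies in `A`. -/
def chance (w : ι → ℝ) (step : S → ι → S) (n : ℕ) (A : Set S) (s : S) : ℝ :=
  iterMean w step n (A.indicator 1) s

variable {w : ι → ℝ} {step : S → ι → S} {G : Set S}

theorem iterMean_add (m n : ℕ) (f : S → ℝ) (s : S) :
    iterMean w step (m + n) f s = iterMean w step m (iterMean w step n f) s := by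
  induction m generalizing s with
  | zero => simp [iterMean]
  | succ m ih =>
    rw [Nat.succ_add]
    simp only [iterMean, ih]

theorem iterMean_succ' (n : ℕ) (f : S → ℝ) (s : S) :
    iterMean w step (n + 1) f s = iterMean w step n (fun s => ∑ i, w i * f (step s i)) s := by
  rw [iterMean_add]; rfl

/-- `G` is a set of states closed under branching, later the genuine channels: the estimates for `Z`
and `I` hold only there, and splitting does not leave it. -/
theorem iterMean_mono (hw : ∀ i, 0 ≤ w i) (hG : ∀ s ∈ G, ∀ i, step s i ∈ G) {f h : S → ℝ}
    (hfh : ∀ s ∈ G, f s ≤ h s) (n : ℕ) {s : S} (hs : s ∈ G) :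
    iterMean w step n f s ≤ iterMean w step n h s := by
  induction n generalizing s with
  | zero => exact hfh s hs
  | succ n ih =>
    exact Finset.sum_le_sum fun i _ => mul_le_mul_of_nonneg_left (ih (hG s hs i)) (hw i)

theorem iterMean_const (hw1 : ∑ i, w i = 1) (c : ℝ) (n : ℕ) (s : S) :
    iterMean w step n (fun _ => c) s = c := by
  induction n generalizing s with
  | zero => rfl
  | succ n ih => simp only [iterMean, ih, ← Finset.sum_mul, hw1, one_mul]

theorem iterMean_add_fun (f h : S → ℝ) (n : ℕ) (s : S) :
    iterMean w step n (fun s => f s + h s) s = iterMean w step n f s + iterMean w step n h s := by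
  induction n generalizing s with
  | zero => rfl
  | succ n ih => simp only [iterMean, ih, mul_add, Finset.sum_add_distrib]

theorem iterMean_const_mul (c : ℝ) (f : S → ℝ) (n : ℕ) (s : S) :
    iterMean w step n (fun s => c * f s) s = c * iterMean w step n f s := by
  induction n generalizing s with
  | zero => rfl
  | succ n ih => simp only [iterMean, ih, Finset.mul_sum, mul_left_comm]

theorem iterMean_eq_self (hG : ∀ s ∈ G, ∀ i, step s i ∈ G) {f : S → ℝ}
    (hf : ∀ s ∈ G, ∑ i, w i * f (step s i) = f s) (n : ℕ) {s : S} (hs : s ∈ G) :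
    iterMean w step n f s = f s := by
  induction n generalizing s with
  | zero => rfl
  | succ n ih =>
    rw [← hf s hs]
    exact Finset.sum_congr rfl fun i _ => by rw [ih (hG s hs i)]

theorem iterMean_tendsto (hG : ∀ s ∈ G, ∀ i, step s i ∈ G) {f : ℕ → S → ℝ} {h : S → ℝ}
    (hf : ∀ s ∈ G, Tendsto (fun n => f n s) atTop (𝓝 (h s))) (m : ℕ) {s : S} (hs : s ∈ G) :
    Tendsto (fun n => iterMean w step m (f n) s) atTop (𝓝 (iterMean w step m h s)) := by
  induction m generalizing s with
  | zero => exact hf s hs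
  | succ m ih =>
    exact tendsto_finsetSum _ fun i _ => (ih (hG s hs i)).const_mul _

theorem chance_nonneg (hw : ∀ i, 0 ≤ w i) (hw1 : ∑ i, w i = 1) (n : ℕ) (A : Set S) (s : S) :
    0 ≤ chance w step n A s := by
  rw [← iterMean_const (w := w) (step := step) hw1 0 n s]
  exact iterMean_mono hw (G := Set.univ) (by simp)
    (fun s _ => Set.indicator_nonneg (by simp) s) n (Set.mem_univ s)

theorem chance_mono (hw : ∀ i, 0 ≤ w i) (hG : ∀ s ∈ G, ∀ i, step s i ∈ G) {A B : Set S}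
    (hAB : ∀ s ∈ G, s ∈ A → s ∈ B) (n : ℕ) {s : S} (hs : s ∈ G) :
    chance w step n A s ≤ chance w step n B s := by
  refine iterMean_mono hw hG (fun s hs => ?_) n hs
  by_cases h : s ∈ A
  · simp [h, hAB s hs h]
  · simpa [h] using Set.indicator_nonneg (by simp) s

theorem chance_compl (hw1 : ∑ i, w i = 1) (n : ℕ) (A : Set S) (s : S) :
    chance w step n A s + chance w step n Aᶜ s = 1 := by
  unfold chance
  rw [← iterMean_add_fun, ← iterMean_const (w := w) (step := step) hw1 1 n s]
  congr 1
  funext s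
  exact congrFun (Set.indicator_self_add_compl A (1 : S → ℝ)) s

theorem chance_le_one (hw : ∀ i, 0 ≤ w i) (hw1 : ∑ i, w i = 1) (n : ℕ) (A : Set S) (s : S) :
    chance w step n A s ≤ 1 := by
  linarith [chance_compl (step := step) hw1 n A s, chance_nonneg (step := step) hw hw1 n Aᶜ s]

theorem chance_le_add (hw : ∀ i, 0 ≤ w i) (hG : ∀ s ∈ G, ∀ i, step s i ∈ G) {A B B' : Set S}
    (hA : ∀ s ∈ G, s ∈ A → s ∈ B ∨ s ∈ B') (n : ℕ) {s : S} (hs : s ∈ G) :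
    chance w step n A s ≤ chance w step n B s + chance w step n B' s := by
  rw [chance, chance, chance, ← iterMean_add_fun]
  refine iterMean_mono hw hG (fun s hs => ?_) n hs
  have h1 : 0 ≤ B.indicator (1 : S → ℝ) s := Set.indicator_nonneg (by simp) s
  have h2 : 0 ≤ B'.indicator (1 : S → ℝ) s := Set.indicator_nonneg (by simp) s
  by_cases h : s ∈ A
  · rcases hA s hs h with h' | h'
    · simp only [Set.indicator_of_mem h, Set.indicator_of_mem h', Pi.one_apply]; linarith
    · simp only [Set.indicator_of_mem h, Set.indicator_of_mem h', Pi.one_apply]; linarith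
  · rw [Set.indicator_of_notMem h]; linarith

theorem chance_add (m n : ℕ) (A : Set S) (s : S) :
    chance w step (m + n) A s = iterMean w step m (chance w step n A) s :=
  iterMean_add m n _ s

/-- Conditioning on the event that the descendant of generation `m` lies in `B`. -/
theorem chance_add_le (hw : ∀ i, 0 ≤ w i) (hw1 : ∑ i, w i = 1)
    (hG : ∀ s ∈ G, ∀ i, step s i ∈ G) (m n : ℕ) {A B : Set S} {c : ℝ} (hc : 0 ≤ c)
    (h : ∀ s ∈ G, s ∈ B → chance w step n A s ≤ c) {s : S} (hs : s ∈ G) :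
    chance w step (m + n) A s ≤ chance w step m Bᶜ s + c := by
  rw [chance_add, ← iterMean_const (w := w) (step := step) hw1 c m s, chance, ← iterMean_add_fun]
  refine iterMean_mono hw hG (fun s hs => ?_) m hs
  by_cases hB : s ∈ B
  · simpa [hB] using h s hs hB
  · have := chance_le_one (step := step) hw hw1 n A s
    simp [hB]; linarith

/-- A potential that contracts in the mean below the level `ζ` stays small. -/
theorem chance_lt_le_of_contract (hw : ∀ i, 0 ≤ w i) (hw1 : ∑ i, w i = 1)
    (hG : ∀ s ∈ G, ∀ i, step s i ∈ G) {z : S → ℝ} (hz : ∀ s ∈ G, 0 ≤ z s) {α ζ ρ : ℝ}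
    (hα : 0 < α) (hζ : 0 < ζ) (hρ : 0 ≤ ρ) (hρ1 : ρ ≤ 1)
    (h : ∀ s ∈ G, z s ≤ ζ → ∑ i, w i * z (step s i) ^ α ≤ ρ * z s ^ α) {t : ℝ} (ht : 0 < t)
    (n : ℕ) {s : S} (hs : s ∈ G) :
    chance w step n {s | t < z s} s ≤ (z s / ζ) ^ α + ρ ^ n * (z s / t) ^ α := by
  induction n generalizing s with
  | zero =>
    have h0 := hz s hs
    have h1 : 0 ≤ (z s / ζ) ^ α := by positivity
    have h2 : 0 ≤ (z s / t) ^ α := by positivity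
    by_cases hts : t < z s
    · have : 1 ≤ (z s / t) ^ α := Real.one_le_rpow (by rw [le_div_iff₀ ht]; linarith) hα.le
      simp [chance, iterMean, hts]; linarith
    · simp [chance, iterMean, hts]; linarith
  | succ n ih =>
    have h0 := hz s hs
    have h2 : 0 ≤ ρ ^ (n + 1) * (z s / t) ^ α := by positivity
    -- Above the level `ζ` the first term of the bound is already at least 1, so no control is
    -- needed after an escape.
    by_cases hzs : z s ≤ ζ
    · have key : ∀ c > 0, ∑ i, w i * (z (step s i) / c) ^ α ≤ ρ * (z s / c) ^ α := by
        intro c hc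
        have e : ∀ i, w i * (z (step s i) / c) ^ α = w i * z (step s i) ^ α / c ^ α := fun i => by
          rw [Real.div_rpow (hz _ (hG s hs i)) hc.le, mul_div_assoc]
        rw [Finset.sum_congr rfl fun i _ => e i, ← Finset.sum_div, Real.div_rpow h0 hc.le,
          ← mul_div_assoc]
        exact div_le_div_of_nonneg_right (h s hs hzs) (by positivity)
      calc chance w step (n + 1) {s | t < z s} s
          = ∑ i, w i * chance w step n {s | t < z s} (step s i) := rfl
        _ ≤ ∑ i, w i * ((z (step s i) / ζ) ^ α + ρ ^ n * (z (step s i) / t) ^ α) :=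
            Finset.sum_le_sum fun i _ => mul_le_mul_of_nonneg_left (ih (hG s hs i)) (hw i)
        _ = ∑ i, w i * (z (step s i) / ζ) ^ α
              + ρ ^ n * ∑ i, w i * (z (step s i) / t) ^ α := by
            rw [Finset.mul_sum, ← Finset.sum_add_distrib]
            exact Finset.sum_congr rfl fun i _ => by ring
        _ ≤ ρ * (z s / ζ) ^ α + ρ ^ n * (ρ * (z s / t) ^ α) :=
            add_le_add (key ζ hζ) (mul_le_mul_of_nonneg_left (key t ht) (by positivity))
        _ ≤ (z s / ζ) ^ α + ρ ^ (n + 1) * (z s / t) ^ α := by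
            have h1 : 0 ≤ (z s / ζ) ^ α := by positivity
            have : ρ * (z s / ζ) ^ α ≤ (z s / ζ) ^ α := by nlinarith
            rw [pow_succ]; nlinarith
    · have : 1 ≤ (z s / ζ) ^ α := Real.one_le_rpow (by rw [le_div_iff₀ hζ]; linarith) hα.le
      linarith [chance_le_one (step := step) hw hw1 (n + 1) {s | t < z s} s]

/-- The moment generating function equals 1 at `σ = 0` and its derivative there is the mean, which
is negative. -/
theorem exists_sum_mul_exp_lt_one (hw1 : ∑ i, w i = 1) {y : ι → ℝ} (hy : ∑ i, w i * y i < 0) :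
    ∃ σ > 0, ∑ i, w i * Real.exp (σ * y i) < 1 := by
  have hd : HasDerivAt (fun σ : ℝ => ∑ i, w i * Real.exp (σ * y i)) (∑ i, w i * y i) 0 := by
    have := HasDerivAt.fun_sum (u := Finset.univ) (x := (0 : ℝ))
      (A := fun i (σ : ℝ) => w i * Real.exp (σ * y i)) (A' := fun i => w i * y i) fun i _ => by
        have h1 : HasDerivAt (fun σ : ℝ => σ * y i) (y i) 0 := by
          simpa using (hasDerivAt_id (0 : ℝ)).mul_const (y i)
        simpa using h1.exp.const_mul (w i)
    exact this
  have hlt := (hasDerivWithinAt_iff_tendsto_slope' (s := Set.Ioi (0 : ℝ)) (by simp)).1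
    hd.hasDerivWithinAt
  have := (hlt.eventually (gt_mem_nhds hy)).and self_mem_nhdsWithin
  obtain ⟨σ, h1, h2⟩ := this.exists
  refine ⟨σ, h2, ?_⟩
  simp only [slope, vsub_eq_sub, sub_zero, zero_mul, Real.exp_zero, mul_one, hw1,
    smul_eq_mul] at h1
  have h3 : 0 < σ := h2
  by_contra hcon
  push Not at hcon
  have : 0 ≤ σ⁻¹ * (∑ i, w i * Real.exp (σ * y i) - 1) :=
    mul_nonneg (by positivity) (by linarith)
  linarith

/-- If the exponent `a` becomes at least `d i * a - c` along the branch `i`, then after `n` steps it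
is of the order of the product of the factors `d i`. -/
theorem chance_compl_le_of_expand (hw : ∀ i, 0 ≤ w i)
    {Q : ℝ → Set S}
    {d : ι → ℝ} (hd : ∀ i, 1 ≤ d i) {c : ℝ} (hc : 0 ≤ c)
    (hQ : ∀ a b, a ≤ b → Q b ⊆ Q a) (hstep : ∀ a, ∀ s ∈ Q a, ∀ i, step s i ∈ Q (d i * a - c))
    {σ : ℝ} (hσ : 0 < σ) {t : ℝ} (ht : 0 < t) (n : ℕ) {a : ℝ} (ha : n * c < a) {s : S}
    (hs : s ∈ Q a) :
    chance w step n (Q t)ᶜ s ≤ (∑ i, w i * d i ^ (-σ)) ^ n * (t / (a - n * c)) ^ σ := by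
  have hκ : 0 ≤ ∑ i, w i * d i ^ (-σ) :=
    Finset.sum_nonneg fun i _ => mul_nonneg (hw i) (Real.rpow_nonneg (by linarith [hd i]) _)
  induction n generalizing s a with
  | zero =>
    simp only [Nat.cast_zero, zero_mul, sub_zero, pow_zero, one_mul] at ha ⊢
    by_cases hts : s ∈ Q t
    · simp [chance, iterMean, hts]; positivity
    · have : a < t := by
        by_contra hcon
        exact hts (hQ t a (not_lt.1 hcon) hs)
      simp [chance, iterMean, hts]
      exact Real.one_le_rpow (by rw [le_div_iff₀ ha]; linarith) hσ.le
  | succ n ih =>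
    push_cast at ha ⊢
    have hpos : 0 < a - (n + 1) * c := by linarith
    -- The right potential is the exponent minus the loss still to come, `a - n * c` with `n` steps
    -- left. As `d i ≥ 1`, a branch multiplies it by at least `d i`.
    have hdi : ∀ i, d i * (a - (n + 1) * c) ≤ d i * a - c - n * c := fun i => by
      have := mul_le_mul_of_nonneg_right (hd i) (by positivity : 0 ≤ (n + 1) * c)
      linarith
    have hdpos : ∀ i, 0 < d i := fun i => by linarith [hd i]
    calc chance w step (n + 1) (Q t)ᶜ s
        = ∑ i, w i * chance w step n (Q t)ᶜ (step s i) := rfl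
      _ ≤ ∑ i, w i * ((∑ i, w i * d i ^ (-σ)) ^ n * (d i ^ (-σ) *
            (t / (a - (n + 1) * c)) ^ σ)) := by
          refine Finset.sum_le_sum fun i _ => mul_le_mul_of_nonneg_left ?_ (hw i)
          have h1 : 0 < d i * (a - (n + 1) * c) := mul_pos (hdpos i) hpos
          refine (ih (a := d i * a - c) (by linarith [hdi i]) (hstep a s hs i)).trans ?_
          refine mul_le_mul_of_nonneg_left ?_ (by positivity)
          rw [Real.rpow_neg (hdpos i).le, ← Real.inv_rpow (hdpos i).le,
            ← Real.mul_rpow (by have := hdpos i; positivity) (by positivity)]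
          refine Real.rpow_le_rpow (div_nonneg ht.le (by linarith [hdi i])) ?_ hσ.le
          rw [inv_mul_eq_div, div_div, mul_comm]
          exact div_le_div_of_nonneg_left ht.le (by linarith) (by linarith [hdi i])
      _ = _ := by
          rw [pow_succ, Finset.mul_sum, Finset.sum_mul]
          exact Finset.sum_congr rfl fun i _ => by ring

/-- If the exponent `a` becomes at most `d i * a + c` along the branch `i`, then after `n` steps it
is of the order of the product of the factors `d i`. -/
theorem chance_compl_le_of_bounded (hw : ∀ i, 0 ≤ w i)
    {Q : ℝ → Set S}
    {d : ι → ℝ} (hd : ∀ i, 1 ≤ d i) {c : ℝ} (hc : 0 ≤ c)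
    (hQ : ∀ a b, a ≤ b → Q a ⊆ Q b)
    (hstep : ∀ a, 0 ≤ a → ∀ s ∈ Q a, ∀ i, step s i ∈ Q (d i * a + c))
    {σ : ℝ} (hσ : 0 < σ) {t : ℝ} (ht : 0 < t) (n : ℕ) {a : ℝ} (ha : 0 ≤ a) {s : S}
    (hs : s ∈ Q a) :
    chance w step n (Q t)ᶜ s ≤ (∑ i, w i * d i ^ σ) ^ n * ((a + n * c) / t) ^ σ := by
  have hκ : 0 ≤ ∑ i, w i * d i ^ σ :=
    Finset.sum_nonneg fun i _ => mul_nonneg (hw i) (Real.rpow_nonneg (by linarith [hd i]) _)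
  induction n generalizing s a with
  | zero =>
    simp only [Nat.cast_zero, zero_mul, add_zero, pow_zero, one_mul]
    by_cases hts : s ∈ Q t
    · simp [chance, iterMean, hts]; positivity
    · have : t < a := by
        by_contra hcon
        exact hts (hQ a t (not_lt.1 hcon) hs)
      simp [chance, iterMean, hts]
      exact Real.one_le_rpow (by rw [le_div_iff₀ ht]; linarith) hσ.le
  | succ n ih =>
    push_cast
    have hdi : ∀ i, d i * a + c + n * c ≤ d i * (a + (n + 1) * c) := fun i => by
      have := mul_le_mul_of_nonneg_right (hd i) (by positivity : 0 ≤ (n + 1) * c)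
      linarith
    have hdpos : ∀ i, 0 < d i := fun i => by linarith [hd i]
    calc chance w step (n + 1) (Q t)ᶜ s
        = ∑ i, w i * chance w step n (Q t)ᶜ (step s i) := rfl
      _ ≤ ∑ i, w i * ((∑ i, w i * d i ^ σ) ^ n * (d i ^ σ *
            ((a + (n + 1) * c) / t) ^ σ)) := by
          refine Finset.sum_le_sum fun i _ => mul_le_mul_of_nonneg_left ?_ (hw i)
          have h0 : 0 ≤ d i * a + c := add_nonneg (mul_nonneg (hdpos i).le ha) hc
          refine (ih h0 (hstep a ha s hs i)).trans ?_
          refine mul_le_mul_of_nonneg_left ?_ (by positivity)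
          rw [← Real.mul_rpow (hdpos i).le (by positivity)]
          refine Real.rpow_le_rpow (by positivity) ?_ hσ.le
          rw [← mul_div_assoc]
          exact div_le_div_of_nonneg_right (hdi i) ht.le
      _ = _ := by
          rw [pow_succ, Finset.mul_sum, Finset.sum_mul]
          exact Finset.sum_congr rfl fun i _ => by ring

end IterMean

/-! ### Growth rates on weighted trees: Chernoff bounds and doubly exponential decay. -/

section IterMeanAsymptotics

variable {S ι : Type*} [Fintype ι] {w : ι → ℝ} {step : S → ι → S} {G : Set S}

/-- Chernoff's bound: `L^(β σ)` times the sum is the moment generating function of `β log L - log (d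
i)`, whose mean is negative by the choice of `β`. -/
theorem exists_sum_mul_rpow_neg_lt (hw1 : ∑ i, w i = 1) {d : ι → ℝ} (hd : ∀ i, 0 < d i) {L β : ℝ}
    (hL : 1 < L) (hβ : β < ∑ i, w i * Real.logb L (d i)) :
    ∃ σ > 0, ∑ i, w i * d i ^ (-σ) < L ^ (-(β * σ)) := by
  have hlog : 0 < Real.log L := Real.log_pos hL
  have e : ∑ i, w i * (β * Real.log L - Real.log (d i)) =
      Real.log L * (β - ∑ i, w i * Real.logb L (d i)) := by
    have : ∀ i, w i * (β * Real.log L - Real.log (d i)) =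
        w i * (Real.log L * β) - Real.log L * (w i * Real.logb L (d i)) := fun i => by
      rw [Real.logb]; field_simp
    rw [Finset.sum_congr rfl fun i _ => this i, Finset.sum_sub_distrib, ← Finset.sum_mul, hw1,
      ← Finset.mul_sum]
    ring
  obtain ⟨σ, hσ, h⟩ := exists_sum_mul_exp_lt_one hw1
    (y := fun i => β * Real.log L - Real.log (d i)) (by
      rw [e]; exact mul_neg_of_pos_of_neg hlog (by linarith))
  refine ⟨σ, hσ, ?_⟩
  have e2 : ∀ i, w i * Real.exp (σ * (β * Real.log L - Real.log (d i))) =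
      w i * d i ^ (-σ) * L ^ (β * σ) := fun i => by
    rw [Real.rpow_def_of_pos (hd i), Real.rpow_def_of_pos (by linarith), mul_assoc, ← Real.exp_add]
    ring_nf
  rw [Finset.sum_congr rfl fun i _ => e2 i, ← Finset.sum_mul] at h
  rw [Real.rpow_neg (by linarith), ← one_div]
  exact (lt_div_iff₀ (Real.rpow_pos_of_pos (by linarith) _)).2 h

theorem exists_sum_mul_rpow_lt (hw1 : ∑ i, w i = 1) {d : ι → ℝ} (hd : ∀ i, 0 < d i) {L β : ℝ}
    (hL : 1 < L) (hβ : ∑ i, w i * Real.logb L (d i) < β) :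
    ∃ σ > 0, ∑ i, w i * d i ^ σ < L ^ (β * σ) := by
  obtain ⟨σ, hσ, h⟩ := exists_sum_mul_rpow_neg_lt hw1 (d := fun i => (d i)⁻¹)
    (fun i => inv_pos.2 (hd i)) hL (β := -β) (by
      simp only [Real.logb_inv, mul_neg, Finset.sum_neg_distrib]; linarith)
  refine ⟨σ, hσ, ?_⟩
  simpa [Real.inv_rpow (hd _).le, Real.rpow_neg (hd _).le] using h

/-- If `z` is multiplied by at most `2 ^ c` along every branch, and is essentially squared along
some branch, then a small power of `z` contracts in the mean, at a rate that beats `2 ^ (-R n)`. -/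
theorem exists_contract (hw : ∀ i, 0 ≤ w i) (hw1 : ∑ i, w i = 1)
    (hG : ∀ s ∈ G, ∀ i, step s i ∈ G) {z : S → ℝ} (hz : ∀ s ∈ G, 0 ≤ z s) {c : ℝ}
    {D : ι → ℕ} (hD : ∀ i, 1 ≤ D i)
    (hstep : ∀ s ∈ G, ∀ i, z (step s i) ≤ 2 ^ c * z s ^ D i)
    {i₀ : ι} (hw0 : 0 < w i₀) (hD0 : 2 ≤ D i₀) (R : ℝ) :
    ∃ α > 0, ∃ ζ > 0, ∃ ρ ≥ 0, ρ ≤ 1 ∧ ρ * 2 ^ (α * R) < 1 ∧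
      ∀ s ∈ G, z s ≤ ζ → ∑ i, w i * z (step s i) ^ α ≤ ρ * z s ^ α := by
  classical
  set p := w i₀ with hp
  have hp1 : p ≤ 1 := hw1 ▸ Finset.single_le_sum (fun i _ => hw i) (Finset.mem_univ i₀)
  have hcont : ∀ b : ℝ, Tendsto (fun α : ℝ => (2 : ℝ) ^ (α * b) * (1 - p / 2)) (𝓝[>] 0)
      (𝓝 (1 - p / 2)) := by
    intro b
    have : Continuous fun α : ℝ => (2 : ℝ) ^ (α * b) * (1 - p / 2) := by
      refine Continuous.mul ?_ continuous_const
      exact Continuous.rpow continuous_const (by fun_prop) (fun x => Or.inl (by norm_num))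
    simpa using (this.tendsto 0).mono_left nhdsWithin_le_nhds
  obtain ⟨α, ⟨h1, h2⟩, h3⟩ := ((((hcont c).eventually (ge_mem_nhds (by linarith : 1 - p / 2 < 1))).and
    ((hcont (c + R)).eventually (gt_mem_nhds (by linarith : 1 - p / 2 < 1)))).and
      self_mem_nhdsWithin).exists
  -- Below `ζ = (1/2)^(1/α)` the quantity `x = z^α` is at most `1/2`, so `x^2 ≤ x/2` on the branch
  -- `i₀`. The mean factor is then `2^(α c) * (1 - p/2)`, and the constants `2^(α c)`, `2^(α R)`
  -- tend to 1 as `α → 0`.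
  have hα : 0 < α := h3
  refine ⟨α, hα, (1 / 2) ^ (1 / α), by positivity, (2 : ℝ) ^ (α * c) * (1 - p / 2),
    mul_nonneg (by positivity) (by linarith), h1, ?_, ?_⟩
  · have : (2 : ℝ) ^ (α * (c + R)) = 2 ^ (α * c) * 2 ^ (α * R) := by
      rw [← Real.rpow_add (by norm_num)]; ring_nf
    rw [this] at h2
    linarith
  · intro s hs hzs
    have h0 := hz s hs
    have hzα : z s ^ α ≤ 1 / 2 := by
      have := Real.rpow_le_rpow h0 hzs hα.le
      rwa [← Real.rpow_mul (by norm_num), one_div_mul_cancel hα.ne', Real.rpow_one] at this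
    set x := z s ^ α with hx
    have hx0 : 0 ≤ x := by positivity
    have hi : ∀ i, z (step s i) ^ α ≤ 2 ^ (α * c) * x ^ D i := fun i => by
      refine (Real.rpow_le_rpow (hz _ (hG s hs i)) (hstep s hs i) hα.le).trans_eq ?_
      rw [Real.mul_rpow (by positivity) (by positivity), ← Real.rpow_mul (by norm_num), hx,
        ← Real.rpow_natCast, ← Real.rpow_mul h0, ← Real.rpow_natCast, ← Real.rpow_mul h0]
      ring_nf
    have hi' : ∀ i, z (step s i) ^ α ≤ 2 ^ (α * c) * (x * (1 - if i = i₀ then 1 / 2 else 0)) := by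
      intro i
      refine (hi i).trans (mul_le_mul_of_nonneg_left ?_ (by positivity))
      split_ifs with h
      · subst h
        calc x ^ D i ≤ x ^ 2 := pow_le_pow_of_le_one hx0 (by linarith) hD0
          _ ≤ _ := by nlinarith
      · calc x ^ D i ≤ x ^ 1 := pow_le_pow_of_le_one hx0 (by linarith) (hD i)
          _ = _ := by ring
    calc ∑ i, w i * z (step s i) ^ α
        ≤ ∑ i, w i * (2 ^ (α * c) * (x * (1 - if i = i₀ then 1 / 2 else 0))) :=
          Finset.sum_le_sum fun i _ => mul_le_mul_of_nonneg_left (hi' i) (hw i)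
      _ = 2 ^ (α * c) * x * ∑ i, (w i - w i * if i = i₀ then 1 / 2 else 0) := by
          rw [Finset.mul_sum]; exact Finset.sum_congr rfl fun i _ => by ring
      _ = _ := by
          rw [Finset.sum_sub_distrib, hw1]
          simp only [mul_ite, mul_zero, Finset.sum_ite_eq', Finset.mem_univ, if_true]
          rw [← hp]; ring

/-- If `z` becomes at most a constant times `z ^ D i` along the branch `i`, and starts small, then
it decays to zero at a doubly exponential rate. -/
theorem eventually_chance_lt_le (hw : ∀ i, 0 ≤ w i) (hw1 : ∑ i, w i = 1)
    (hG : ∀ s ∈ G, ∀ i, step s i ∈ G) {z : S → ℝ} (hz : ∀ s ∈ G, 0 ≤ z s) {c : ℝ} (hc : 0 ≤ c)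
    {D : ι → ℕ} (hD : ∀ i, 1 ≤ D i)
    (hstep : ∀ s ∈ G, ∀ i, z (step s i) ≤ 2 ^ c * z s ^ D i)
    {i₀ : ι} (hw0 : 0 < w i₀) (hD0 : 2 ≤ D i₀) {L β : ℝ} (hL : 1 < L) (hβ0 : 0 ≤ β)
    (hβ : β < ∑ i, w i * Real.logb L (D i)) {η : ℝ} (hη : 0 < η) :
    ∃ ε > 0, ∀ T : ℝ, ∀ᶠ n : ℕ in atTop, ∀ s ∈ G, z s ≤ ε →
      chance w step n {s | (2 : ℝ) ^ (-(L ^ (β * (T + n)))) < z s} s ≤ η := by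
  have hL0 : 0 < L := by linarith
  obtain ⟨β', hβ1, hβ2⟩ := exists_between hβ
  have hβ'0 : 0 < β' := by linarith
  obtain ⟨σ, hσ, hκ⟩ := exists_sum_mul_rpow_neg_lt hw1 (d := fun i => (D i : ℝ))
    (fun i => by have := hD i; positivity) hL hβ2
  -- This bound on `k` says `β' * (1 - 1/k) > β`: sacrificing `n / k` of the `n` steps to the
  -- contraction stage still leaves a rate above `β`.
  obtain ⟨k, hk⟩ := exists_nat_gt (β' / (β' - β))
  have hk1 : 1 < (k : ℝ) := lt_of_le_of_lt
    ((one_le_div (by linarith)).2 (by linarith)) hk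
  have hk0 : 0 < k := by
    have : (0 : ℝ) < k := by linarith
    exact_mod_cast this
  have hδ : 0 < β' * (1 - 1 / k) - β := by
    rw [div_lt_iff₀ (by linarith)] at hk
    have : β' / k < β' - β := by rw [div_lt_iff₀ (by linarith)]; linarith
    have e : β' * (1 - 1 / k) = β' - β' / k := by ring
    linarith
  set δ := β' * (1 - 1 / k) - β with hδdef
  -- For `n ≥ 2k` and `m = n / k` one has `n ≤ 2 k m`, so `R * m ≥ (c + 1) * n`: the exponent won in
  -- the first stage exceeds all later additive losses by at least 1.
  set R := (c + 1) * (2 * k) with hR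
  obtain ⟨α, hα, ζ, hζ, ρ, hρ, hρ1, hρR, hcontr⟩ :=
    exists_contract hw hw1 hG hz hD hstep hw0 hD0 R
  -- The second entry limits the chance of an escape above `ζ` to `η / 3`; `ε ≤ 1` is used for the
  -- chance of contracting too slowly.
  set ε := min 1 (ζ * (η / 3) ^ (1 / α)) with hε
  have hε0 : 0 < ε := by positivity
  have hεα : (ε / ζ) ^ α ≤ η / 3 := by
    have : ε / ζ ≤ (η / 3) ^ (1 / α) := by
      rw [div_le_iff₀ hζ, mul_comm]; exact min_le_right _ _
    have := Real.rpow_le_rpow (by positivity) this hα.le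
    rwa [← Real.rpow_mul (by positivity), one_div_mul_cancel hα.ne', Real.rpow_one] at this
  refine ⟨ε, hε0, fun T => ?_⟩
  have hm : Tendsto (fun n : ℕ => n / k) atTop atTop := Nat.tendsto_div_const_atTop hk0.ne'
  have hlim1 : Tendsto (fun n : ℕ => (ρ * 2 ^ (α * R)) ^ (n / k)) atTop (𝓝 0) :=
    (tendsto_pow_atTop_nhds_zero_of_lt_one (by positivity) hρR).comp hm
  have hlim2 : Tendsto (fun n : ℕ => L ^ (-(σ * (δ * n - β * T)))) atTop (𝓝 0) := by
    refine (tendsto_rpow_atBot_of_base_gt_one L hL).comp ?_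
    refine tendsto_neg_atTop_atBot.comp (Tendsto.const_mul_atTop hσ ?_)
    exact tendsto_atTop_add_const_right _ _
      (tendsto_natCast_atTop_atTop.const_mul_atTop hδ)
  filter_upwards [hlim1.eventually (ge_mem_nhds (by positivity : 0 < η / 3)),
    hlim2.eventually (ge_mem_nhds (by positivity : 0 < η / 3)),
    eventually_ge_atTop (2 * k)] with n hn1 hn2 hn3 s hs hzs
  obtain ⟨m, hmdef⟩ : ∃ m, m = n / k := ⟨_, rfl⟩
  rw [← hmdef] at hn1
  have hmn : m ≤ n := hmdef ▸ Nat.div_le_self n k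
  have hmk : (m : ℝ) * k ≤ n := by
    have := Nat.div_mul_le_self n k
    rw [← hmdef] at this; exact_mod_cast this
  have hmk2 : (n : ℝ) ≤ 2 * k * m := by
    have h1 := Nat.lt_div_mul_add (a := n) (b := k) hk0
    rw [← hmdef] at h1
    have h2 : (n : ℝ) < m * k + k := by exact_mod_cast h1
    have h3 : (2 : ℝ) * k ≤ n := by exact_mod_cast hn3
    nlinarith
  obtain ⟨j, rfl⟩ := Nat.exists_eq_add_of_le hmn
  set n := m + j with hn
  have hjn : (j : ℝ) = n - m := by rw [hn]; push_cast; ring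
  set t := L ^ (β * (T + (n : ℕ))) with ht
  have ht0 : 0 < t := by positivity
  have hRm : (c + 1) * n ≤ R * m := by
    rw [hR, mul_assoc]
    exact mul_le_mul_of_nonneg_left hmk2 (by linarith)
  have hn1' : (1 : ℝ) ≤ n := by
    have : (2 : ℝ) * k ≤ n := by exact_mod_cast hn3
    linarith
  have hgap : 1 ≤ R * m - j * c := by
    have : (j : ℝ) * c ≤ n * c := mul_le_mul_of_nonneg_right (by rw [hjn]; linarith [Nat.cast_nonneg (α := ℝ) m]) hc
    nlinarith
  have hstage : ∀ s ∈ G, s ∈ {s | z s ≤ 2 ^ (-(R * m))} →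
      chance w step j {s | (2 : ℝ) ^ (-t) < z s} s ≤ η / 3 := by
    intro s hs hzs
    have hsub : chance w step j {s | (2 : ℝ) ^ (-t) < z s} s
        ≤ chance w step j (G ∩ {s | z s ≤ 2 ^ (-t)})ᶜ s :=
      chance_mono hw hG (fun s _ h => by
        simp only [Set.mem_compl_iff, Set.mem_inter_iff, Set.mem_ofPred_eq, not_and, not_le]
        exact fun _ => h) j hs
    have hmain := chance_compl_le_of_expand (step := step) hw
      (Q := fun a => G ∩ {s | z s ≤ 2 ^ (-a)})
      (d := fun i => (D i : ℝ)) (fun i => by exact_mod_cast hD i) hc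
      (fun a b hab s hs => ⟨hs.1, hs.2.trans (Real.rpow_le_rpow_of_exponent_le (by norm_num)
        (by linarith))⟩)
      (fun a s hs i => ⟨hG s hs.1 i, by
        refine (hstep s hs.1 i).trans ?_
        refine (mul_le_mul_of_nonneg_left (pow_le_pow_left₀ (hz s hs.1) hs.2 (D i))
          (by positivity)).trans_eq ?_
        rw [← Real.rpow_natCast, ← Real.rpow_mul (by norm_num), ← Real.rpow_add (by norm_num)]
        congr 1; ring⟩)
      hσ ht0 j (a := R * m) (by linarith) ⟨hs, hzs⟩
    refine hsub.trans (hmain.trans (le_trans ?_ hn2))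
    have hκ0 : 0 ≤ ∑ i, w i * (D i : ℝ) ^ (-σ) :=
      Finset.sum_nonneg fun i _ => mul_nonneg (hw i) (by positivity)
    calc (∑ i, w i * (D i : ℝ) ^ (-σ)) ^ j * (t / (R * m - j * c)) ^ σ
        ≤ (L ^ (-(β' * σ))) ^ j * t ^ σ := by
          refine mul_le_mul (pow_le_pow_left₀ hκ0 hκ.le j) ?_ (by positivity) (by positivity)
          refine Real.rpow_le_rpow (by positivity) ?_ hσ.le
          exact div_le_self ht0.le hgap
      _ = L ^ (-(β' * σ) * j + β * (T + n) * σ) := by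
          rw [← Real.rpow_natCast, ← Real.rpow_mul hL0.le, ht, ← Real.rpow_mul hL0.le,
            ← Real.rpow_add hL0]
      _ ≤ L ^ (-(σ * (δ * n - β * T))) := by
          refine Real.rpow_le_rpow_of_exponent_le hL.le ?_
          have h1 : (1 - 1 / k) * (n : ℝ) ≤ j := by
            have : (m : ℝ) ≤ n / k := by rw [le_div_iff₀ (by linarith)]; exact hmk
            rw [hjn]; ring_nf; ring_nf at this; linarith
          have h2 := mul_le_mul_of_nonneg_left h1 (mul_pos hβ'0 hσ).le
          rw [hδdef]
          nlinarith
  refine (chance_add_le hw hw1 hG m j (by positivity) hstage hs).trans ?_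
  have hfirst := chance_lt_le_of_contract hw hw1 hG hz hα hζ hρ hρ1 hcontr
    (t := 2 ^ (-(R * m))) (by positivity) m hs
  have e : ({s | z s ≤ (2 : ℝ) ^ (-(R * m))})ᶜ = {s | (2 : ℝ) ^ (-(R * m)) < z s} := by
    ext s; simp
  rw [e]
  have h0 := hz s hs
  have b1 : (z s / ζ) ^ α ≤ η / 3 :=
    (Real.rpow_le_rpow (by positivity) (div_le_div_of_nonneg_right hzs hζ.le) hα.le).trans hεα
  have b2 : ρ ^ m * (z s / 2 ^ (-(R * m))) ^ α ≤ η / 3 := by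
    refine le_trans ?_ hn1
    rw [mul_pow]
    refine mul_le_mul_of_nonneg_left ?_ (by positivity)
    rw [← Real.rpow_natCast (2 ^ (α * R)) m, ← Real.rpow_mul (by norm_num)]
    have : z s / 2 ^ (-(R * m)) ≤ 2 ^ (R * m) := by
      rw [Real.rpow_neg (by norm_num), div_inv_eq_mul]
      exact mul_le_of_le_one_left (by positivity) (hzs.trans (min_le_left _ _))
    refine (Real.rpow_le_rpow (by positivity) this hα.le).trans_eq ?_
    rw [← Real.rpow_mul (by norm_num)]
    ring_nf
  linarith

/-- If the exponent `a` becomes at most `D i * a + c` along the branch `i`, then it grows at most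
exponentially, at the rate given by the mean of `log (D i)`. -/
theorem tendsto_chance_compl_of_bounded (hw : ∀ i, 0 ≤ w i) (hw1 : ∑ i, w i = 1)
    {Q : ℝ → Set S} {D : ι → ℕ} (hD : ∀ i, 1 ≤ D i) {c : ℝ} (hc : 0 ≤ c)
    (hQ : ∀ a b, a ≤ b → Q a ⊆ Q b)
    (hstep : ∀ a, 0 ≤ a → ∀ s ∈ Q a, ∀ i, step s i ∈ Q (D i * a + c)) {L β : ℝ} (hL : 1 < L)
    (hβ : ∑ i, w i * Real.logb L (D i) < β) {T : ℝ} {a : ℝ} (ha : 0 ≤ a) {s : S}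
    (hs : s ∈ Q a) :
    Tendsto (fun n : ℕ => chance w step n (Q (L ^ (β * (T + n))))ᶜ s) atTop (𝓝 0) := by
  have hL0 : 0 < L := by linarith
  obtain ⟨σ, hσ, hκ⟩ := exists_sum_mul_rpow_lt hw1 (d := fun i => (D i : ℝ))
    (fun i => by have := hD i; positivity) hL hβ
  have hκ0 : 0 ≤ ∑ i, w i * (D i : ℝ) ^ σ :=
    Finset.sum_nonneg fun i _ => mul_nonneg (hw i) (by positivity)
  set κ := ∑ i, w i * (D i : ℝ) ^ σ
  -- Pulling the power `σ` outside turns the bound into `(a r^n + c n r^n)^σ` up to a constant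
  -- factor, with `r < 1`; the linear factor `n` is harmless.
  set r := (κ / L ^ (β * σ)) ^ (1 / σ) with hr
  have hr0 : 0 ≤ r := by positivity
  have hr1 : r < 1 := Real.rpow_lt_one (by positivity)
    ((div_lt_one (by positivity)).2 hκ) (by positivity)
  have hlim : Tendsto (fun n : ℕ => ((a * r ^ n + c * (n * r ^ n)) * L ^ (-(β * T))) ^ σ) atTop
      (𝓝 0) := by
    have h1 := (tendsto_pow_atTop_nhds_zero_of_lt_one hr0 hr1).const_mul a
    have h2 := (tendsto_self_mul_const_pow_of_lt_one hr0 hr1).const_mul c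
    have h3 := ((h1.add h2).mul_const (L ^ (-(β * T)))).rpow_const (p := σ) (Or.inr hσ.le)
    simpa [Real.zero_rpow hσ.ne'] using h3
  refine tendsto_of_tendsto_of_tendsto_of_le_of_le tendsto_const_nhds hlim
    (fun n => chance_nonneg hw hw1 n _ s) fun n => ?_
  refine (chance_compl_le_of_bounded hw (d := fun i => (D i : ℝ))
    (fun i => by exact_mod_cast hD i) hc hQ hstep hσ
    (Real.rpow_pos_of_pos hL0 (β * (T + n))) n ha hs).trans_eq ?_
  have e1 : κ ^ n = (r ^ n * L ^ (β * n)) ^ σ := by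
    have hrσ : r ^ σ = κ / L ^ (β * σ) := by
      rw [hr, ← Real.rpow_mul (by positivity), one_div_mul_cancel hσ.ne', Real.rpow_one]
    rw [Real.mul_rpow (by positivity) (by positivity), ← Real.rpow_natCast r, ← Real.rpow_mul hr0,
      mul_comm (n : ℝ) σ, Real.rpow_mul hr0, hrσ, Real.rpow_natCast, div_pow,
      ← Real.rpow_mul hL0.le, ← Real.rpow_natCast (L ^ (β * σ)), ← Real.rpow_mul hL0.le,
      show β * ↑n * σ = β * σ * ↑n by ring, div_mul_cancel₀ _ (by positivity)]
  show κ ^ n * _ = _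
  rw [e1, ← Real.mul_rpow (by positivity) (by positivity)]
  congr 1
  rw [mul_add, Real.rpow_add hL0, Real.rpow_neg hL0.le]
  field_simp

end IterMeanAsymptotics

/-! ### From measures on branch sequences to weighted sums over finite paths. -/

section Paths

variable {S ι : Type*}

/-- The descendant of `s` at the end of a path of `n` branches. -/
def endOfPath (step : S → ι → S) (s : S) : (n : ℕ) → (Fin n → ι) → S
  | 0, _ => s
  | n + 1, x => step (endOfPath step s n (Fin.init x)) (x (Fin.last n))

variable [Fintype ι] {w : ι → ℝ} {step : S → ι → S}

theorem sum_prod_mul_endOfPath (f : S → ℝ) (n : ℕ) (s : S) :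
    ∑ x : Fin n → ι, (∏ k, w (x k)) * f (endOfPath step s n x) = iterMean w step n f s := by
  induction n generalizing f with
  | zero => simp [endOfPath, iterMean]
  | succ n ih =>
    rw [iterMean_succ', ← ih, ← (Fin.snocEquiv fun _ => ι).sum_comp, Fintype.sum_prod_type_right]
    refine Finset.sum_congr rfl fun x _ => ?_
    rw [Finset.mul_sum]
    refine Finset.sum_congr rfl fun i _ => ?_
    simp [endOfPath, Fin.snocEquiv, Fin.prod_univ_castSucc, mul_assoc]

/-- A process that is driven by an i.i.d. sequence of branches. -/
theorem measureReal_eq_chance {Ω : Type*} [MeasurableSpace Ω] {μ : Measure Ω} [IsFiniteMeasure μ]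
    {B : ℕ → Ω → ι}
    (hB : ∀ n (x : Fin n → ι), MeasurableSet {ω | ∀ k : Fin n, B k ω = x k} ∧
      μ.real {ω | ∀ k : Fin n, B k ω = x k} = ∏ k, w (x k))
    {X : Ω → ℕ → S} {s : S} (h0 : ∀ ω, X ω 0 = s)
    (hX : ∀ ω n, X ω (n + 1) = step (X ω n) (B n ω)) (n : ℕ) (A : Set S) :
    μ.real {ω | X ω n ∈ A} = chance w step n A s := by
  classical
  have hend : ∀ ω n, X ω n = endOfPath step s n fun k => B k ω := by
    intro ω n
    induction n with
    | zero => exact h0 ω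
    | succ n ih => rw [hX, ih]; rfl
  -- The state at time `n` depends on the first `n` branches only, so the event is a finite disjoint
  -- union of cylinders, whatever the set `A`.
  have hset : {ω | X ω n ∈ A} =
      ⋃ x ∈ Finset.univ.filter (fun x : Fin n → ι => endOfPath step s n x ∈ A),
        {ω | ∀ k : Fin n, B k ω = x k} := by
    ext ω
    simp only [Set.mem_iUnion, Finset.mem_filter, Finset.mem_univ, true_and, exists_prop]
    constructor
    · intro h
      exact ⟨fun k => B k ω, by rw [← hend]; exact h, fun k => rfl⟩
    · rintro ⟨x, hx, hω⟩
      have : (fun k : Fin n => B k ω) = x := funext hω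
      change X ω n ∈ A
      rw [hend, this]; exact hx
  rw [hset, measureReal_biUnion_finset, chance, ← sum_prod_mul_endOfPath, Finset.sum_filter]
  · refine Finset.sum_congr rfl fun x _ => ?_
    rw [(hB n x).2]
    by_cases h : endOfPath step s n x ∈ A <;> simp [h]
  · intro x _ y _ hxy
    refine Set.disjoint_left.2 fun ω hx hy => hxy (funext fun k => ?_)
    exact (hx k).symm.trans (hy k)
  · exact fun x _ => (hB n x).1

theorem infinitePi_toMeasure_prefix {α : Type*} [MeasurableSpace α] [MeasurableSingletonClass α]
    (p : PMF α) (n : ℕ) (x : Fin n → α) :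
    MeasurableSet {ω : ℕ → α | ∀ k : Fin n, ω k = x k} ∧
      Measure.infinitePi (fun _ : ℕ => p.toMeasure) {ω | ∀ k : Fin n, ω k = x k} =
        ∏ k, p (x k) := by
  classical
  set t : ℕ → Set α := fun k => if h : k < n then {x ⟨k, h⟩} else Set.univ with ht
  have htm : ∀ k, MeasurableSet (t k) := fun k => by
    simp only [ht]; split_ifs
    · exact measurableSet_singleton _
    · exact MeasurableSet.univ
  have e : {ω : ℕ → α | ∀ k : Fin n, ω k = x k} = Set.pi (Finset.range n) t := by
    ext ω
    constructor
    · intro h k hk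
      have hk' : k < n := by simpa using hk
      simpa [ht, hk'] using h ⟨k, hk'⟩
    · intro h k
      simpa [ht] using h k (by simp)
  rw [e]
  refine ⟨MeasurableSet.pi (Finset.countable_toSet _) fun k _ => htm k, ?_⟩
  rw [Measure.infinitePi_pi _ (fun k _ => htm k), Finset.prod_range]
  refine Finset.prod_congr rfl fun k _ => ?_
  simp [ht, PMF.toMeasure_apply_singleton]

end Paths

instance (ℓ : ℕ) [NeZero ℓ] : IsProbabilityMeasure (uniformBranches ℓ) := by
  unfold uniformBranches; infer_instance

theorem uniformBranches_prefix {ℓ : ℕ} [NeZero ℓ] (n : ℕ) (x : Fin n → Fin ℓ) :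
    MeasurableSet {ω : ℕ → Fin ℓ | ∀ k : Fin n, ω k = x k} ∧
      uniformBranches ℓ {ω | ∀ k : Fin n, ω k = x k} = ∏ _k : Fin n, (ℓ : ℝ≥0∞)⁻¹ := by
  simpa [uniformBranches] using infinitePi_toMeasure_prefix (PMF.uniformOfFintype (Fin ℓ)) n x

theorem SymKernel.measureReal_treeChannel {ℓ b : ℕ} [NeZero ℓ] (g : SymKernel ℓ b)
    (C : Transition (Symb b)) (n : ℕ) (A : Set (Transition (Symb b))) :
    (uniformBranches ℓ).real {ω | g.treeChannel C ω n ∈ A} =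
      chance (fun _ : Fin ℓ => (ℓ : ℝ)⁻¹)
        (fun C i => Transition.split (A := fun _ : Fin ℓ => Symb b) g C i) n A C := by
  refine measureReal_eq_chance (B := fun n ω => ω n) (fun n x => ?_)
    (fun _ => rfl) (fun _ _ => rfl) n A
  refine ⟨(uniformBranches_prefix n x).1, ?_⟩
  rw [measureReal_def, (uniformBranches_prefix n x).2]
  simp

namespace MixedKernel

/-- The branch probabilities of the tree process, when a branch consists of an input of the binary
kernel and one input of each auxiliary kernel. -/
def weight (K : MixedKernel) (a : Fin K.r × (K.Glued → Fin K.ℓ)) : ℝ :=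
  (K.m a.1 : ℝ) / K.ℓ * ∏ _i : K.Glued, (K.ℓ : ℝ)⁻¹

/-- The descendants of a node of the channel tree. -/
def step (K : MixedKernel) : Node K → Fin K.r × (K.Glued → Fin K.ℓ) → Node K
  | .single C, a => K.splitSingle C a.1
  | .glued i C, a =>
    .glued i (Transition.split (A := fun _ : Fin K.ℓ => Symb (K.m i)) (K.aux i) C (a.2 i))

instance (K : MixedKernel) : IsProbabilityMeasure K.prob := by
  unfold MixedKernel.prob; infer_instance

theorem measureReal_treeChannel (K : MixedKernel) (C : Transition Bool) (n : ℕ) (A : Set (Node K)) :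
    K.prob.real {ω | K.treeChannel C ω n ∈ A} = chance K.weight K.step n A (.single C) := by
  refine measureReal_eq_chance (B := fun n ω => (ω.1 n, fun i => ω.2 i n)) (fun n x => ?_)
    (fun _ => rfl) (fun ω n => ?_) n A
  · have e : {ω : K.Sample | ∀ k : Fin n, (ω.1 k, fun i => ω.2 i k) = x k} =
        {ω | ∀ k : Fin n, ω k = (x k).1} ×ˢ
          Set.pi Set.univ fun i => {ω | ∀ k : Fin n, ω k = (x k).2 i} := by
      ext ω
      simp only [Prod.ext_iff, funext_iff, Set.mem_prod, Set.mem_pi, Set.mem_univ, true_implies]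
      exact ⟨fun h => ⟨fun k => (h k).1, fun i k => (h k).2 i⟩,
        fun h k => ⟨h.1 k, fun i => h.2 i k⟩⟩
    have h1 := infinitePi_toMeasure_prefix K.inputLaw n fun k => (x k).1
    have h2 := fun i => uniformBranches_prefix n fun k => (x k).2 i
    rw [e]
    refine ⟨h1.1.prod (MeasurableSet.univ_pi fun i => (h2 i).1), ?_⟩
    rw [measureReal_def, MixedKernel.prob, Measure.prod_prod, Measure.pi_pi, h1.2,
      Finset.prod_congr rfl fun i _ => (h2 i).2, ENNReal.toReal_mul, ENNReal.toReal_prod,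
      ENNReal.toReal_prod]
    simp only [ENNReal.toReal_prod]
    rw [Finset.prod_comm, ← Finset.prod_mul_distrib]
    simp [MixedKernel.inputLaw, weight]
  · rw [MixedKernel.treeChannel]
    cases K.treeChannel C ω n <;> rfl

end MixedKernel

/-! ### The information density of a vector of likelihoods -/

section Density

variable {X : Type*} [Fintype X]

/-- The contribution to the mutual information of an output with the likelihoods `a x`. -/
def infoDensity (a : X → ℝ) : ℝ :=
  ∑ x, (Fintype.card X : ℝ)⁻¹ * a x *
    Real.logb 2 (a x / ((Fintype.card X : ℝ)⁻¹ * ∑ x', a x'))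

theorem infoDensity_comp_equiv {X' : Type*} [Fintype X'] (e : X ≃ X') (a : X' → ℝ) :
    infoDensity (fun x => a (e x)) = infoDensity a := by
  simp only [infoDensity, e.sum_comp a, Fintype.card_congr e]
  exact e.sum_comp fun x => (Fintype.card X' : ℝ)⁻¹ * a x *
    Real.logb 2 (a x / ((Fintype.card X' : ℝ)⁻¹ * ∑ x', a x'))

/-- Relative entropy dominates the squared Hellinger distance, pointwise. -/
theorem sq_sqrt_sub_sqrt_le {p m : ℝ} (hp : 0 ≤ p) (hm : 0 ≤ m) (hpm : m = 0 → p = 0) :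
    (√p - √m) ^ 2 + (p - m) ≤ p * Real.log (p / m) := by
  rcases hp.eq_or_lt with rfl | hp
  · simp [Real.sq_sqrt hm]
  · have hm' : 0 < m := hm.lt_of_ne fun h => hp.ne' (hpm h.symm)
    -- The whole inequality is `log y ≤ y - 1` at `y = √m / √p`, multiplied by `-2 p`.
    have h1 : Real.log (√m / √p) ≤ √m / √p - 1 := Real.log_le_sub_one_of_pos (by positivity)
    have h2 : Real.log (p / m) = -2 * Real.log (√m / √p) := by
      rw [← Real.sqrt_div hm, Real.log_sqrt (by positivity), ← inv_div m p, Real.log_inv]; ring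
    have h3 : p * (√m / √p) = √m * √p := by
      have hs : 0 < √p := Real.sqrt_pos.2 hp
      nth_rw 1 [← Real.mul_self_sqrt hp.le]
      field_simp
    rw [h2]
    nlinarith [Real.sq_sqrt hp.le, Real.sq_sqrt hm]

variable {a : X → ℝ}

theorem inv_card_mul_sum_nonneg (ha : ∀ x, 0 ≤ a x) : 0 ≤ (Fintype.card X : ℝ)⁻¹ * ∑ x, a x :=
  mul_nonneg (by positivity) (Finset.sum_nonneg fun x _ => ha x)

theorem eq_zero_of_mean_eq_zero (ha : ∀ x, 0 ≤ a x) (x : X)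
    (h : (Fintype.card X : ℝ)⁻¹ * ∑ x, a x = 0) : a x = 0 := by
  have : Nonempty X := ⟨x⟩
  have h1 : (Fintype.card X : ℝ)⁻¹ ≠ 0 := by
    have := Fintype.card_ne_zero (α := X)
    positivity
  have h2 := (mul_eq_zero.1 h).resolve_left h1
  exact (Finset.sum_eq_zero_iff_of_nonneg fun x _ => ha x).1 h2 x (Finset.mem_univ x)

/-- The density is a mean of relative entropy terms. Bounding each by a squared Hellinger term
leaves linear corrections `a x - m`, which cancel because `m` is the mean. -/
theorem sum_sq_le_infoDensity (ha : ∀ x, 0 ≤ a x) :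
    (Fintype.card X : ℝ)⁻¹ * ∑ x, (√(a x) - √((Fintype.card X : ℝ)⁻¹ * ∑ x', a x')) ^ 2 ≤
      Real.log 2 * infoDensity a := by
  rcases isEmpty_or_nonempty X with h | h
  · simp [infoDensity]
  set q : ℝ := (Fintype.card X : ℝ)
  have hq : 0 < q := by simpa [q] using Fintype.card_pos (α := X)
  set m := q⁻¹ * ∑ x', a x' with hm
  have hsum : ∑ x, (a x - m) = 0 := by
    rw [Finset.sum_sub_distrib, Finset.sum_const, nsmul_eq_mul, hm, Finset.card_univ]
    change _ - q * _ = 0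
    field_simp; ring
  calc q⁻¹ * ∑ x, (√(a x) - √m) ^ 2
      = q⁻¹ * ∑ x, ((√(a x) - √m) ^ 2 + (a x - m)) := by
        rw [Finset.sum_add_distrib, hsum, add_zero]
    _ ≤ q⁻¹ * ∑ x, a x * Real.log (a x / m) := by
        refine mul_le_mul_of_nonneg_left (Finset.sum_le_sum fun x _ => ?_) (by positivity)
        exact sq_sqrt_sub_sqrt_le (ha x) (inv_card_mul_sum_nonneg ha)
          (eq_zero_of_mean_eq_zero ha x)
    _ = Real.log 2 * infoDensity a := by
        have : Real.log 2 ≠ 0 := (Real.log_pos (by norm_num)).ne'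
        rw [infoDensity, Finset.mul_sum, Finset.mul_sum]
        refine Finset.sum_congr rfl fun x _ => ?_
        change _ = Real.log 2 * (q⁻¹ * a x * Real.logb 2 (a x / m))
        rw [Real.logb]
        field_simp

theorem infoDensity_nonneg (ha : ∀ x, 0 ≤ a x) : 0 ≤ infoDensity a := by
  have h := sum_sq_le_infoDensity ha
  have h1 : 0 ≤ (Fintype.card X : ℝ)⁻¹ *
      ∑ x, (√(a x) - √((Fintype.card X : ℝ)⁻¹ * ∑ x', a x')) ^ 2 :=
    mul_nonneg (by positivity) (Finset.sum_nonneg fun x _ => sq_nonneg _)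
  exact nonneg_of_mul_nonneg_right (h1.trans h) (Real.log_pos (by norm_num))

/-- The gap to the maximal value is the conditional entropy of the input; `-log₂ p ≥ 1 - p` for the
posterior probabilities `p = a x / s` bounds it from below. -/
theorem infoDensity_add_le (ha : ∀ x, 0 ≤ a x) :
    infoDensity a + (Fintype.card X : ℝ)⁻¹ * ∑ x, a x * (∑ x', a x' - a x) / ∑ x', a x' ≤
      (Fintype.card X : ℝ)⁻¹ * (∑ x, a x) * Real.logb 2 (Fintype.card X) := by
  rcases isEmpty_or_nonempty X with h | h
  · simp [infoDensity]
  set q : ℝ := (Fintype.card X : ℝ)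
  have hq : 0 < q := by simpa [q] using Fintype.card_pos (α := X)
  set s := ∑ x', a x' with hs
  have hlog2 : 0 < Real.log 2 := Real.log_pos (by norm_num)
  have hlog2' : Real.log 2 ≤ 1 := by linarith [Real.log_two_lt_d9]
  have hright : q⁻¹ * s * Real.logb 2 q = ∑ x, q⁻¹ * (a x * Real.logb 2 q) := by
    rw [← Finset.mul_sum, ← Finset.sum_mul, mul_assoc]
  rw [hright, Finset.mul_sum _ (fun x => a x * (s - a x) / s), infoDensity,
    ← Finset.sum_add_distrib]
  refine Finset.sum_le_sum fun x _ => ?_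
  change q⁻¹ * a x * Real.logb 2 (a x / (q⁻¹ * s)) + _ ≤ _
  rw [mul_assoc, ← mul_add]
  refine mul_le_mul_of_nonneg_left ?_ (by positivity)
  rcases (ha x).eq_or_lt with h0 | h0
  · simp [← h0]
  have hsx : a x ≤ s := Finset.single_le_sum (fun x _ => ha x) (Finset.mem_univ x)
  have hs0 : 0 < s := by linarith
  have e : Real.logb 2 (a x / (q⁻¹ * s)) = Real.logb 2 q + Real.logb 2 (a x / s) := by
    rw [← Real.logb_mul (by positivity) (by positivity)]
    congr 1; field_simp
  -- Dividing the nonpositive number `p - 1` by `log 2 ≤ 1` can only decrease it.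
  have h1 : Real.logb 2 (a x / s) ≤ a x / s - 1 := by
    rw [Real.logb, div_le_iff₀ hlog2]
    have h2 := Real.log_le_sub_one_of_pos (by positivity : 0 < a x / s)
    have h3 : a x / s ≤ 1 := (div_le_one hs0).2 hsx
    nlinarith
  rw [e, mul_div_assoc, ← mul_add]
  refine mul_le_mul_of_nonneg_left ?_ h0.le
  rw [sub_div, div_self hs0.ne']
  linarith

theorem infoDensity_le (ha : ∀ x, 0 ≤ a x) :
    infoDensity a ≤ (Fintype.card X : ℝ)⁻¹ * (∑ x, a x) * Real.logb 2 (Fintype.card X) := by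
  refine le_trans (le_add_of_nonneg_right ?_) (infoDensity_add_le ha)
  refine mul_nonneg (by positivity) (Finset.sum_nonneg fun x _ => div_nonneg (mul_nonneg (ha x) ?_)
    (Finset.sum_nonneg fun x _ => ha x))
  exact sub_nonneg.2 (Finset.single_le_sum (fun x _ => ha x) (Finset.mem_univ x))

/-- Only one term of the entropy gap is kept: the one in which `x` is confused with `x'`. -/
theorem infoDensity_add_mul_div_le (ha : ∀ x, 0 ≤ a x) {x x' : X} (hx : x ≠ x') :
    infoDensity a + (Fintype.card X : ℝ)⁻¹ * (a x * a x' / ∑ x, a x) ≤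
      (Fintype.card X : ℝ)⁻¹ * (∑ x, a x) * Real.logb 2 (Fintype.card X) := by
  classical
  refine le_trans ((add_le_add_iff_left _).2 (mul_le_mul_of_nonneg_left ?_ (by positivity)))
    (infoDensity_add_le ha)
  have hsub : ∀ x, 0 ≤ ∑ x', a x' - a x := fun x =>
    sub_nonneg.2 (Finset.single_le_sum (fun x _ => ha x) (Finset.mem_univ x))
  have h0 : 0 ≤ ∑ x, a x := Finset.sum_nonneg fun x _ => ha x
  refine le_trans ?_ (Finset.single_le_sum
    (f := fun x => a x * (∑ x', a x' - a x) / ∑ x', a x')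
    (fun x _ => div_nonneg (mul_nonneg (ha x) (hsub x)) h0) (Finset.mem_univ x))
  refine div_le_div_of_nonneg_right (mul_le_mul_of_nonneg_left ?_ (ha x)) h0
  have := Finset.add_le_sum (f := a) (fun x _ => ha x) (Finset.mem_univ x) (Finset.mem_univ x') hx
  linarith

/-- The terms of the information density are bounded by a multiple of the total likelihood. -/
theorem abs_mul_logb_le (ha : ∀ x, 0 ≤ a x) (x : X) :
    |(Fintype.card X : ℝ)⁻¹ * a x * Real.logb 2 (a x / ((Fintype.card X : ℝ)⁻¹ * ∑ x', a x'))| ≤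
      (Fintype.card X / Real.log 2) * ∑ x', a x' := by
  have : Nonempty X := ⟨x⟩
  set q : ℝ := (Fintype.card X : ℝ)
  have hq : 1 ≤ q := by
    have := Fintype.card_pos (α := X)
    have : 1 ≤ Fintype.card X := this
    simpa [q] using this
  have hlog2 : 0 < Real.log 2 := Real.log_pos (by norm_num)
  have hS : 0 ≤ ∑ x', a x' := Finset.sum_nonneg fun x _ => ha x
  have hxS : a x ≤ ∑ x', a x' := Finset.single_le_sum (fun x _ => ha x) (Finset.mem_univ x)
  have hlow := sq_sqrt_sub_sqrt_le (ha x) (inv_card_mul_sum_nonneg ha)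
    (eq_zero_of_mean_eq_zero ha x)
  change _ ≤ a x * Real.log (a x / (q⁻¹ * ∑ x', a x')) at hlow
  set S := ∑ x', a x'
  have hqi : q⁻¹ ≤ 1 := inv_le_one_of_one_le₀ hq
  have hqi0 : 0 ≤ q⁻¹ := by positivity
  have hup : a x * Real.log (a x / (q⁻¹ * S)) ≤ q * S := by
    rcases (ha x).eq_or_lt with h0 | h0
    · rw [← h0]; simp; positivity
    · have hS' : 0 < S := by linarith
      have h1 : a x / (q⁻¹ * S) ≤ q := by
        rw [div_le_iff₀ (by positivity)]
        field_simp; linarith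
      have h2 := Real.log_le_sub_one_of_pos (by positivity : 0 < a x / (q⁻¹ * S))
      calc _ ≤ a x * q := mul_le_mul_of_nonneg_left (by linarith) h0.le
        _ ≤ _ := by nlinarith
  have habs : |a x * Real.log (a x / (q⁻¹ * S))| ≤ q * S := by
    refine abs_le.2 ⟨?_, hup⟩
    have h1 : q⁻¹ * S ≤ q * S := mul_le_mul_of_nonneg_right (by linarith) hS
    nlinarith [sq_nonneg (√(a x) - √(q⁻¹ * S)), ha x]
  have e : q⁻¹ * a x * Real.logb 2 (a x / (q⁻¹ * S)) =
      q⁻¹ / Real.log 2 * (a x * Real.log (a x / (q⁻¹ * S))) := by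
    rw [Real.logb]; field_simp
  rw [e, abs_mul, abs_of_nonneg (by positivity)]
  calc q⁻¹ / Real.log 2 * |a x * Real.log (a x / (q⁻¹ * S))|
      ≤ 1 / Real.log 2 * (q * S) := by
        refine mul_le_mul (div_le_div_of_nonneg_right hqi hlog2.le) habs (abs_nonneg _)
          (by positivity)
    _ = _ := by ring

end Density

/-! ### The chain rule of mutual information, for one fixed output. -/

section ChainRule

variable {r : ℕ} {A : Fin r → Type*} [∀ j, Fintype (A j)] [∀ j, DecidableEq (A j)]

/-- The total weight of the sequences that agree with `v` at the first `k` positions. -/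
def prefixSum (F : (∀ j, A j) → ℝ) (k : ℕ) (v : ∀ j, A j) : ℝ :=
  ∑ v', if ∀ j : Fin r, (j : ℕ) < k → v' j = v j then F v' else 0

/-- The likelihoods of the `i`-th symbol, for the preceding symbols `u`, when the symbols have the
joint likelihood `F`. -/
def splitLikelihood (F : (∀ j, A j) → ℝ) (i : Fin r)
    (u : ∀ j : {j : Fin r // j < i}, A j) (x : A i) : ℝ :=
  (∏ j ∈ Finset.univ.erase i, (Fintype.card (A j) : ℝ))⁻¹ *
    ∑ v : (∀ j, A j),
      if v i = x ∧ ∀ j : {j : Fin r // j < i}, v j = u j then F v else 0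

theorem sum_sum_ite_prefix (i : Fin r)
    (H : (∀ j, A j) → ℝ) :
    ∑ u : (∀ j : {j : Fin r // j < i}, A j), ∑ x : A i, ∑ v : (∀ j, A j),
      (if v i = x ∧ ∀ j : {j : Fin r // j < i}, v j = u j then H v else 0) = ∑ v, H v := by
  have h1 : ∀ u : (∀ j : {j : Fin r // j < i}, A j), ∑ x : A i, ∑ v : (∀ j, A j),
      (if v i = x ∧ ∀ j : {j : Fin r // j < i}, v j = u j then H v else 0) =
      ∑ v : (∀ j, A j), if (fun j : {j : Fin r // j < i} => v j) = u then H v else 0 := by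
    intro u
    rw [Finset.sum_comm]
    refine Finset.sum_congr rfl fun v _ => ?_
    by_cases h : ∀ j : {j : Fin r // j < i}, v j = u j
    · simp [h]
    · rw [if_neg fun hu => h (funext_iff.1 hu)]
      exact Finset.sum_eq_zero fun x _ => if_neg fun hx => h hx.2
  rw [Finset.sum_congr rfl fun u _ => h1 u, Finset.sum_comm]
  simp

theorem prefixSum_zero (F : (∀ j, A j) → ℝ) (v : ∀ j, A j) : prefixSum F 0 v = ∑ v', F v' := by
  simp [prefixSum]

theorem prefixSum_last (F : (∀ j, A j) → ℝ) (v : ∀ j, A j) : prefixSum F r v = F v := by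
  have : ∀ v' : ∀ j, A j, (∀ j : Fin r, (j : ℕ) < r → v' j = v j) ↔ v' = v := fun v' =>
    ⟨fun h => funext fun j => h j j.2, fun h j _ => h ▸ rfl⟩
  unfold prefixSum
  simp_rw [this]
  simp

theorem prefixSum_pos {F : (∀ j, A j) → ℝ} (hF : ∀ v, 0 ≤ F v) (k : ℕ) {v : ∀ j, A j}
    (hv : 0 < F v) : 0 < prefixSum F k v := by
  unfold prefixSum
  refine hv.trans_le ?_
  refine le_trans ?_ (Finset.single_le_sum
    (f := fun v' => if ∀ j : Fin r, (j : ℕ) < k → v' j = v j then F v' else 0)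
    (fun v' _ => by split_ifs <;> simp [hF]) (Finset.mem_univ v))
  simp

/-- Together with the next formula for the total likelihood, this makes the posterior of the `i`-th
symbol a ratio of consecutive prefix sums; the normalization cancels. -/
theorem splitLikelihood_eq_prefixSum (F : (∀ j, A j) → ℝ) (i : Fin r) (v : ∀ j, A j) :
    splitLikelihood F i (fun j => v j) (v i) =
      (∏ j ∈ Finset.univ.erase i, (Fintype.card (A j) : ℝ))⁻¹ * prefixSum F (i + 1) v := by
  unfold splitLikelihood prefixSum
  congr 1
  refine Finset.sum_congr rfl fun v' _ => ?_
  refine if_congr ⟨fun h j hj => ?_, fun h => ⟨h i (by simp), fun j => h j ?_⟩⟩ rfl rfl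
  · rcases (Nat.lt_succ_iff_lt_or_eq.1 hj) with hj | hj
    · exact h.2 ⟨j, hj⟩
    · obtain rfl : j = i := Fin.ext hj
      exact h.1
  · exact Nat.lt_succ_of_lt j.2

theorem sum_splitLikelihood_eq_prefixSum (F : (∀ j, A j) → ℝ) (i : Fin r) (v : ∀ j, A j) :
    ∑ x, splitLikelihood F i (fun j => v j) x =
      (∏ j ∈ Finset.univ.erase i, (Fintype.card (A j) : ℝ))⁻¹ * prefixSum F i v := by
  unfold splitLikelihood prefixSum
  rw [← Finset.mul_sum, Finset.sum_comm]
  congr 1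
  refine Finset.sum_congr rfl fun v' _ => ?_
  have : (∀ j : {j : Fin r // j < i}, v' j = v j) ↔ ∀ j : Fin r, (j : ℕ) < i → v' j = v j :=
    ⟨fun h j hj => h ⟨j, hj⟩, fun h j => h j j.2⟩
  by_cases h : ∀ j : {j : Fin r // j < i}, v' j = v j
  · rw [if_pos (this.1 h)]
    simp [h]
  · rw [if_neg fun h' => h (this.2 h')]
    exact Finset.sum_eq_zero fun x _ => if_neg fun hx => h hx.2

/-- The chain rule of mutual information, for a single output. -/
theorem sum_infoDensity_splitLikelihood {F : (∀ j, A j) → ℝ} (hF : ∀ v, 0 ≤ F v) :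
    ∑ i, ∑ u, infoDensity (splitLikelihood F i u) = infoDensity F := by
  rcases isEmpty_or_nonempty (∀ j, A j) with hV | hV
  · have h1 : ∀ i u x, splitLikelihood F i u x = 0 := fun i u x => by simp [splitLikelihood]
    simp [infoDensity, h1]
  have hA : ∀ j, Nonempty (A j) := fun j => hV.map fun v => v j
  have hq : ∀ j, (0 : ℝ) < Fintype.card (A j) := fun j => by exact_mod_cast Fintype.card_pos
  set N : ℝ := (Fintype.card (∀ j, A j) : ℝ) with hN
  have hNprod : N = ∏ j, (Fintype.card (A j) : ℝ) := by rw [hN, Fintype.card_pi]; push_cast; rfl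
  have hN0 : 0 < N := by rw [hNprod]; exact Finset.prod_pos fun j _ => hq j
  -- Written as a mean over full sequences `v`, the `i`-th density has the logarithm of a ratio of
  -- consecutive prefix sums, so the sum over `i` telescopes.
  have hterm : ∀ i, ∑ u, infoDensity (splitLikelihood F i u) = ∑ v, N⁻¹ * F v *
      (Real.logb 2 (Fintype.card (A i)) +
        (Real.logb 2 (prefixSum F (i + 1) v) - Real.logb 2 (prefixSum F i v))) := by
    intro i
    set c : ℝ := (∏ j ∈ Finset.univ.erase i, (Fintype.card (A j) : ℝ))⁻¹ with hc
    have hc0 : 0 < c := inv_pos.2 (Finset.prod_pos fun j _ => hq j)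
    have hcN : (Fintype.card (A i) : ℝ)⁻¹ * c = N⁻¹ := by
      rw [hc, ← mul_inv, Finset.mul_prod_erase _ (fun j => (Fintype.card (A j) : ℝ))
        (Finset.mem_univ i), ← hNprod]
    rw [← sum_sum_ite_prefix i]
    refine Finset.sum_congr rfl fun u _ => Finset.sum_congr rfl fun x _ => ?_
    rw [show (Fintype.card (A i) : ℝ)⁻¹ * splitLikelihood F i u x = N⁻¹ * ∑ v : (∀ j, A j),
      if v i = x ∧ ∀ j : {j : Fin r // j < i}, v j = u j then F v else 0 by
        rw [← hcN, mul_assoc]; rfl, mul_assoc, Finset.sum_mul, Finset.mul_sum]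
    refine Finset.sum_congr rfl fun v _ => ?_
    split_ifs with h
    · obtain ⟨rfl, h⟩ := h
      obtain rfl : (fun j : {j : Fin r // j < i} => v j) = u := funext h
      rw [← mul_assoc]
      rcases (hF v).eq_or_lt with h0 | h0
      · simp [← h0]
      congr 1
      have p1 := prefixSum_pos hF (i + 1) h0
      have p2 := prefixSum_pos hF i h0
      have hqi := hq i
      rw [splitLikelihood_eq_prefixSum, sum_splitLikelihood_eq_prefixSum, ← hc,
        ← Real.logb_div p1.ne' p2.ne', ← Real.logb_mul hqi.ne' (by positivity)]
      congr 1
      field_simp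
    · simp
  rw [Finset.sum_congr rfl fun i _ => hterm i, Finset.sum_comm, infoDensity]
  refine Finset.sum_congr rfl fun v _ => ?_
  change _ = N⁻¹ * F v * Real.logb 2 (F v / (N⁻¹ * ∑ v', F v'))
  rw [← Finset.mul_sum]
  rcases (hF v).eq_or_lt with h0 | h0
  · simp [← h0]
  congr 1
  have hS : 0 < ∑ v', F v' := prefixSum_zero F v ▸ prefixSum_pos hF 0 h0
  have htel : ∑ i : Fin r, (Real.logb 2 (prefixSum F (i + 1) v) - Real.logb 2 (prefixSum F i v)) =
      Real.logb 2 (F v) - Real.logb 2 (∑ v', F v') := by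
    rw [← Finset.sum_range fun k => Real.logb 2 (prefixSum F (k + 1) v) -
      Real.logb 2 (prefixSum F k v), Finset.sum_range_sub fun k => Real.logb 2 (prefixSum F k v),
      prefixSum_last, prefixSum_zero]
  rw [Finset.sum_add_distrib, htel, ← Real.logb_prod _ _ (fun j _ => (hq j).ne'), ← hNprod,
    ← Real.logb_div h0.ne' hS.ne', ← Real.logb_mul hN0.ne' (by positivity)]
  congr 1
  field_simp

/-- The information density of a product of likelihoods. -/
theorem infoDensity_prod {X : Type*} [Fintype X] {ℓ : ℕ} {a : Fin ℓ → X → ℝ}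
    (ha : ∀ k x, 0 ≤ a k x) :
    infoDensity (fun x : Fin ℓ → X => ∏ k, a k (x k)) =
      ∑ k', ∏ k, if k = k' then infoDensity (a k) else (Fintype.card X : ℝ)⁻¹ * ∑ x, a k x := by
  classical
  set q : ℝ := (Fintype.card X : ℝ) with hq
  have hmean : (Fintype.card (Fin ℓ → X) : ℝ)⁻¹ * ∑ x : Fin ℓ → X, ∏ k, a k (x k) =
      ∏ k, (q⁻¹ * ∑ x, a k x) := by
    rw [Finset.prod_mul_distrib, Finset.prod_univ_sum, Fintype.piFinset_univ]
    simp [q]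
  -- The logarithm of the product is a sum over `k'`. Each summand is again a product over the
  -- coordinates, with the logarithm sitting in the factor `k'` alone.
  have hfactor : ∀ k' k, (if k = k' then infoDensity (a k) else q⁻¹ * ∑ x, a k x) =
      ∑ x, q⁻¹ * a k x * (if k = k' then Real.logb 2 (a k x / (q⁻¹ * ∑ x, a k x)) else 1) := by
    intro k' k
    split_ifs
    · rfl
    · simp [Finset.mul_sum]
  simp only [hfactor, Finset.prod_univ_sum, Fintype.piFinset_univ]
  rw [infoDensity, Finset.sum_comm]
  simp only [hmean]
  refine Finset.sum_congr rfl fun x _ => ?_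
  simp only [Finset.prod_mul_distrib, ← Finset.mul_sum, Finset.prod_ite_eq', Finset.mem_univ,
    if_true]
  have e : (Fintype.card (Fin ℓ → X) : ℝ)⁻¹ = ∏ _k : Fin ℓ, q⁻¹ := by simp [q]
  rw [e]
  by_cases h0 : ∏ k, a k (x k) = 0
  · simp [h0]
  congr 1
  have hne : ∀ k, a k (x k) ≠ 0 := fun k hk => h0 (Finset.prod_eq_zero (Finset.mem_univ k) hk)
  rw [← Finset.prod_mul_distrib, ← Finset.prod_div_distrib, Real.logb_prod]
  intro k _
  exact div_ne_zero (hne k) fun h => hne k (eq_zero_of_mean_eq_zero (ha k) (x k) h)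

end ChainRule

/-! ### Sums over product alphabets. -/

section Sums

/-- Output alphabets may be infinite; this is how the sum over `ℓ` independent channel outputs
factorizes. -/
theorem HasSum.prod_fin {β : Type*} {n : ℕ} {f : Fin n → β → ℝ} {a : Fin n → ℝ}
    (h : ∀ k, HasSum (f k) (a k)) :
    HasSum (fun y : Fin n → β => ∏ k, f k (y k)) (∏ k, a k) := by
  induction n with
  | zero => simp
  | succ n ih =>
    have h1 := ih fun k => h k.succ
    have hs : Summable fun p : β × (Fin n → β) => f 0 p.1 * ∏ k : Fin n, f k.succ (p.2 k) :=
      summable_mul_of_summable_norm (h 0).summable.norm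
        (g := fun y : Fin n → β => ∏ k : Fin n, f k.succ (y k)) h1.summable.norm
    have h2 := HasSum.mul (f := f 0) (g := fun y : Fin n → β => ∏ k : Fin n, f k.succ (y k))
      (h 0) h1 hs
    rw [Fin.prod_univ_succ, ← (Fin.consEquiv fun _ => β).hasSum_iff]
    have e : (fun y : Fin (n + 1) → β => ∏ k, f k (y k)) ∘ (Fin.consEquiv fun _ => β) =
        fun p : β × (Fin n → β) => f 0 p.1 * ∏ k : Fin n, f k.succ (p.2 k) :=
      funext fun p => by simp [Fin.prod_univ_succ, Fin.consEquiv]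
    rwa [e]

theorem HasSum.prod_fintype {β U : Type*} [Fintype U] {f : β × U → ℝ} {a : U → ℝ}
    (h : ∀ u, HasSum (fun y => f (y, u)) (a u)) : HasSum f (∑ u, a u) := by
  classical
  have h1 : ∀ u, HasSum (fun p : β × U => if p.2 = u then f p else 0) (a u) := by
    intro u
    have hinj : Function.Injective fun y : β => (y, u) := fun y y' hy => congrArg Prod.fst hy
    rw [← hinj.hasSum_iff]
    · simpa [Function.comp_def] using h u
    · rintro ⟨y, u'⟩ hy
      have : u' ≠ u := by
        rintro rfl
        exact hy ⟨y, rfl⟩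
      simp [this]
  simpa using hasSum_sum fun u (_ : u ∈ Finset.univ) => h1 u

theorem Real.sqrt_sum_le {α : Type*} (s : Finset α) (f : α → ℝ) (hf : ∀ x, 0 ≤ f x) :
    √(∑ x ∈ s, f x) ≤ ∑ x ∈ s, √(f x) := by
  classical
  induction s using Finset.induction_on with
  | empty => simp
  | insert x s hx ih =>
    rw [Finset.sum_insert hx, Finset.sum_insert hx]
    have h1 : 0 ≤ ∑ x ∈ s, f x := Finset.sum_nonneg fun x _ => hf x
    refine le_trans (Real.sqrt_le_iff.2 ⟨by positivity, ?_⟩) (add_le_add le_rfl ih)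
    nlinarith [Real.sq_sqrt (hf x), Real.sq_sqrt h1, Real.sqrt_nonneg (f x),
      mul_nonneg (Real.sqrt_nonneg (f x)) (Real.sqrt_nonneg (∑ x ∈ s, f x))]

end Sums

namespace Transition

variable {X : Type} {C : Transition X}

/-! ### Bhattacharyya coefficients -/

theorem IsChannel.summable_sqrt (hC : C.IsChannel) (x x' : X) :
    Summable fun y => √(C.prob x y * C.prob x' y) := by
  refine Summable.of_nonneg_of_le (fun y => Real.sqrt_nonneg _) (fun y => ?_)
    ((hC.2 x).summable.add (hC.2 x').summable)
  have h1 := hC.1 x y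
  have h2 := hC.1 x' y
  exact Real.sqrt_le_iff.2 ⟨by positivity, by nlinarith⟩

theorem IsChannel.hasSum_bhattPair (hC : C.IsChannel) (x x' : X) :
    HasSum (fun y => √(C.prob x y * C.prob x' y)) (C.bhattPair x x') :=
  (hC.summable_sqrt x x').hasSum

theorem bhattPair_nonneg (C : Transition X) (x x' : X) : 0 ≤ C.bhattPair x x' :=
  tsum_nonneg fun _ => Real.sqrt_nonneg _

theorem IsChannel.bhattPair_le_one (hC : C.IsChannel) (x x' : X) : C.bhattPair x x' ≤ 1 := by
  have h := ((hC.2 x).add (hC.2 x')).div_const 2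
  refine (hasSum_le (fun y => ?_) (hC.hasSum_bhattPair x x') h).trans (by norm_num)
  have h1 := hC.1 x y
  have h2 := hC.1 x' y
  exact Real.sqrt_le_iff.2 ⟨by positivity, by nlinarith [sq_nonneg (C.prob x y - C.prob x' y)]⟩

theorem IsChannel.bhattPair_self (hC : C.IsChannel) (x : X) : C.bhattPair x x = 1 := by
  simp only [bhattPair, Real.sqrt_mul_self (hC.1 x _), (hC.2 x).tsum_eq]

section Bhatt

variable [Fintype X] [DecidableEq X]

theorem bhatt_nonneg [Nonempty X] (C : Transition X) : 0 ≤ C.bhatt := by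
  have h : (1 : ℝ) ≤ Fintype.card X := by
    have : 1 ≤ Fintype.card X := Fintype.card_pos
    exact_mod_cast this
  refine mul_nonneg (inv_nonneg.2 (mul_nonneg (by positivity) (by linarith)))
    (Finset.sum_nonneg fun p _ => ?_)
  split_ifs
  · exact C.bhattPair_nonneg _ _
  · exact le_rfl

theorem card_mul_card_sub_one_eq :
    (Fintype.card X : ℝ) * ((Fintype.card X : ℝ) - 1) =
      ∑ p : X × X, if p.1 ≠ p.2 then (1 : ℝ) else 0 := by
  rw [Fintype.sum_prod_type]
  have : ∀ x : X, (∑ y, if (x, y).1 ≠ (x, y).2 then (1 : ℝ) else 0) = (Fintype.card X : ℝ) - 1 := by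
    intro x
    have h : ∀ y, (if x ≠ y then (1 : ℝ) else 0) = 1 - if x = y then 1 else 0 := fun y => by
      by_cases h : x = y <;> simp [h]
    simp [h]
  rw [Finset.sum_congr rfl fun x _ => this x]
  simp [mul_sub]

theorem card_mul_card_sub_one_pos {X : Type} [Fintype X] [Nontrivial X] :
    0 < (Fintype.card X : ℝ) * ((Fintype.card X : ℝ) - 1) := by
  have h : (1 : ℝ) < Fintype.card X := by exact_mod_cast Fintype.one_lt_card (α := X)
  exact mul_pos (by linarith) (by linarith)

theorem bhatt_le [Nontrivial X] {c : ℝ} (h : ∀ x x', x ≠ x' → C.bhattPair x x' ≤ c) :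
    C.bhatt ≤ c := by
  rw [bhatt, inv_mul_le_iff₀ card_mul_card_sub_one_pos, card_mul_card_sub_one_eq, Finset.sum_mul]
  refine Finset.sum_le_sum fun p _ => ?_
  split_ifs with hp
  · simpa using h _ _ hp
  · simp

theorem le_bhatt [Nontrivial X] {c : ℝ} (h : ∀ x x', x ≠ x' → c ≤ C.bhattPair x x') :
    c ≤ C.bhatt := by
  rw [bhatt, le_inv_mul_iff₀ card_mul_card_sub_one_pos, card_mul_card_sub_one_eq, Finset.sum_mul]
  refine Finset.sum_le_sum fun p _ => ?_
  split_ifs with hp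
  · simpa using h _ _ hp
  · simp

theorem bhattPair_le_bhatt [Nontrivial X] {x x' : X} (hx : x ≠ x') :
    C.bhattPair x x' ≤ (Fintype.card X : ℝ) * ((Fintype.card X : ℝ) - 1) * C.bhatt := by
  rw [bhatt, mul_inv_cancel_left₀ card_mul_card_sub_one_pos.ne']
  refine le_trans ?_ (Finset.single_le_sum
    (f := fun p : X × X => if p.1 ≠ p.2 then C.bhattPair p.1 p.2 else 0) (fun p _ => ?_)
    (Finset.mem_univ (x, x')))
  · simp [hx]
  · split_ifs
    · exact C.bhattPair_nonneg _ _
    · exact le_rfl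

end Bhatt

/-! ### Mutual information -/

theorem IsChannel.hasSum_mean [Fintype X] [Nonempty X] (hC : C.IsChannel) :
    HasSum (fun y => (Fintype.card X : ℝ)⁻¹ * ∑ x, C.prob x y) 1 := by
  have h := (hasSum_sum fun x (_ : x ∈ Finset.univ) => hC.2 x).mul_left (Fintype.card X : ℝ)⁻¹
  have hq : (Fintype.card X : ℝ) ≠ 0 := by exact_mod_cast Fintype.card_ne_zero
  simpa [hq] using h

theorem IsChannel.hasSum_infoDensity [Fintype X] (hC : C.IsChannel) :
    HasSum (fun y => infoDensity fun x => C.prob x y) C.info := by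
  refine hasSum_sum fun x _ => Summable.hasSum ?_
  refine Summable.of_norm_bounded
    (g := fun y => (Fintype.card X / Real.log 2) * ∑ x', C.prob x' y) ?_ fun y => ?_
  · exact (summable_sum fun x _ => (hC.2 x).summable).mul_left _
  · exact abs_mul_logb_le (a := fun x => C.prob x y) (fun x => hC.1 x y) x

theorem IsChannel.info_nonneg [Fintype X] (hC : C.IsChannel) : 0 ≤ C.info :=
  hC.hasSum_infoDensity.nonneg fun y => infoDensity_nonneg fun x => hC.1 x y

theorem IsChannel.info_le [Fintype X] [Nonempty X] (hC : C.IsChannel) :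
    C.info ≤ Real.logb 2 (Fintype.card X) := by
  have h := hasSum_le (fun y => infoDensity_le fun x => hC.1 x y) hC.hasSum_infoDensity
    (hC.hasSum_mean.mul_right (Real.logb 2 (Fintype.card X)))
  simpa using h

/-- If the mutual information is almost maximal, the Bhattacharyya coefficients are small. -/
theorem IsChannel.bhattPair_le_of_info [Fintype X] (hC : C.IsChannel) {x x' : X} (hx : x ≠ x') {lam : ℝ}
    (hlam : 0 < lam) :
    C.bhattPair x x' ≤ (lam⁻¹ * (Fintype.card X * (Real.logb 2 (Fintype.card X) - C.info)) +
      lam * Fintype.card X) / 2 := by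
  have : Nonempty X := ⟨x⟩
  set q : ℝ := (Fintype.card X : ℝ) with hq
  have hq0 : 0 < q := by simpa [q] using Fintype.card_pos (α := X)
  have h1 := ((((hC.hasSum_mean.mul_right (Real.logb 2 q)).sub
    hC.hasSum_infoDensity).mul_left (lam⁻¹ * q)).add (hC.hasSum_mean.mul_left (lam * q))).div_const 2
  refine (hasSum_le (fun y => ?_) (hC.hasSum_bhattPair x x') h1).trans_eq (by ring)
  have h2 := infoDensity_add_mul_div_le (a := fun x => C.prob x y) (fun x => hC.1 x y) hx
  have ha := hC.1 x y
  have hb := hC.1 x' y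
  have has : C.prob x y ≤ ∑ x, C.prob x y :=
    Finset.single_le_sum (fun x _ => hC.1 x y) (Finset.mem_univ x)
  set a := C.prob x y
  set b := C.prob x' y
  set S := ∑ x, C.prob x y
  have h3 : a * b / S ≤ q * (q⁻¹ * S * Real.logb 2 q - infoDensity fun x => C.prob x y) := by
    rw [← inv_mul_le_iff₀ hq0]; linarith
  -- Arithmetic-geometric mean for `λ⁻¹ a b / S` and `λ S`: the first is controlled by the missing
  -- information, the second is small once `λ` is.
  have h4 : √(a * b) ≤ (lam⁻¹ * (a * b / S) + lam * S) / 2 := by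
    rcases (ha.trans has).eq_or_lt with h0 | h0
    · have : a = 0 := le_antisymm (h0 ▸ has) ha
      simp [this, ← h0]
    · refine Real.sqrt_le_iff.2 ⟨by positivity, ?_⟩
      have e : lam⁻¹ * (a * b / S) * (lam * S) = a * b := by field_simp
      nlinarith [sq_nonneg (lam⁻¹ * (a * b / S) - lam * S)]
  have h5 := mul_le_mul_of_nonneg_left h3 (inv_pos.2 hlam).le
  have e : lam * q * (q⁻¹ * S) = lam * S := by field_simp
  change √(a * b) ≤ (lam⁻¹ * q * _ + lam * q * (q⁻¹ * S)) / 2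
  rw [e, mul_assoc]
  linarith

/-- If the mutual information is small, the Bhattacharyya coefficients are almost one. -/
theorem IsChannel.le_bhattPair_of_info [Fintype X] (hC : C.IsChannel) {x x' : X} (hx : x ≠ x') :
    1 - Fintype.card X * (Real.log 2 * C.info) ≤ C.bhattPair x x' := by
  classical
  have : Nonempty X := ⟨x⟩
  have hq0 : (0 : ℝ) < Fintype.card X := by simpa using Fintype.card_pos (α := X)
  have h1 := (hC.hasSum_infoDensity.mul_left (Real.log 2)).mul_left (Fintype.card X : ℝ)
  have h2 := (((hC.2 x).add (hC.2 x')).div_const 2).sub (hC.hasSum_bhattPair x x')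
  have h3 := hasSum_le (fun y => ?_) h2 h1
  · linarith
  have h4 := sum_sq_le_infoDensity (a := fun x => C.prob x y) (fun x => hC.1 x y)
  rw [inv_mul_le_iff₀ hq0] at h4
  refine le_trans ?_ h4
  set m := √((Fintype.card X : ℝ)⁻¹ * ∑ x', C.prob x' y)
  refine le_trans ?_ (Finset.add_le_sum (f := fun x => (√(C.prob x y) - m) ^ 2)
    (fun x _ => sq_nonneg _) (Finset.mem_univ x) (Finset.mem_univ x') hx)
  -- The left side is `(√a - √b)^2 / 2`, at most the sum of the squared distances of `√a` and `√b`
  -- to any common point `m`.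
  rw [Real.sqrt_mul (hC.1 x y)]
  nlinarith [Real.sq_sqrt (hC.1 x y), Real.sq_sqrt (hC.1 x' y),
    sq_nonneg ((√(C.prob x y) - m) + (√(C.prob x' y) - m))]

/-! ### Relabelling the input -/

/-- The channel with a relabelled input. -/
def relabel {X' : Type} (C : Transition X) (e : X' → X) : Transition X' where
  Out := C.Out
  prob := fun x => C.prob (e x)

theorem IsChannel.relabel {X' : Type} (hC : C.IsChannel) (e : X' → X) : (C.relabel e).IsChannel :=
  ⟨fun x y => hC.1 (e x) y, fun x => hC.2 (e x)⟩

theorem IsChannel.info_relabel [Fintype X] {X' : Type} [Fintype X'] (hC : C.IsChannel) {e : X' → X}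
    (he : Function.Bijective e) : (C.relabel e).info = C.info := by
  refine (hC.relabel e).hasSum_infoDensity.unique ?_
  have h : (fun y : C.Out => infoDensity fun x => C.prob (e x) y) =
      fun y => infoDensity fun x => C.prob x y :=
    funext fun y => infoDensity_comp_equiv (Equiv.ofBijective e he) fun x => C.prob x y
  exact h ▸ hC.hasSum_infoDensity

/-! ### Split channels -/

section Split

variable {r ℓ : ℕ} {A : Fin r → Type} [∀ j, Fintype (A j)] [∀ j, DecidableEq (A j)]
  {g : (∀ j, A j) → Fin ℓ → X}

theorem split_prob (i : Fin r) (x : A i) (y : Fin ℓ → C.Out)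
    (u : ∀ j : {j : Fin r // j < i}, A j) :
    (split g C i).prob x (y, u) = splitLikelihood (fun v => ∏ k, C.prob (g v k) (y k)) i u x := rfl

theorem IsChannel.likelihood_nonneg (hC : C.IsChannel) {ι : Type*} {ℓ : ℕ}
    {g : ι → Fin ℓ → X} (y : Fin ℓ → C.Out) (v : ι) : 0 ≤ ∏ k, C.prob (g v k) (y k) :=
  Finset.prod_nonneg fun _ _ => hC.1 _ _

theorem sum_ite_eq_card (i : Fin r) (x : A i) :
    (∑ v : (∀ j, A j), if v i = x then (1 : ℝ) else 0) =
      ∏ j ∈ Finset.univ.erase i, (Fintype.card (A j) : ℝ) := by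
  have h : (Finset.univ.filter fun v : (∀ j, A j) => v i = x) =
      Fintype.piFinset (Function.update (fun j => (Finset.univ : Finset (A j))) i {x}) := by
    ext v
    simp only [Finset.mem_filter, Finset.mem_univ, true_and, Fintype.mem_piFinset]
    constructor
    · intro hv j
      by_cases hj : j = i
      · subst hj; simp [hv]
      · simp [hj]
    · intro hv
      simpa using hv i
  rw [Finset.sum_boole, h, Fintype.card_piFinset, ← Finset.mul_prod_erase _ _ (Finset.mem_univ i)]
  simp only [Function.update_self, Finset.card_singleton, one_mul]
  push_cast
  refine Finset.prod_congr rfl fun j hj => ?_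
  rw [Function.update_of_ne (Finset.ne_of_mem_erase hj), Finset.card_univ]

theorem IsChannel.split (hC : C.IsChannel) (g : (∀ j, A j) → Fin ℓ → X) (i : Fin r)
    (hA : ∀ j, Nonempty (A j)) : (split g C i).IsChannel := by
  refine ⟨?_, fun x => ?_⟩
  · rintro x ⟨y, u⟩
    rw [split_prob]
    refine mul_nonneg (inv_nonneg.2 (Finset.prod_nonneg fun j _ => by positivity))
      (Finset.sum_nonneg fun v _ => ?_)
    split_ifs
    · exact hC.likelihood_nonneg y v
    · exact le_rfl
  · have h1 : ∀ u : (∀ j : {j : Fin r // j < i}, A j), HasSum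
        (fun y : Fin ℓ → C.Out => (Transition.split g C i).prob x (y, u))
        ((∏ j ∈ Finset.univ.erase i, (Fintype.card (A j) : ℝ))⁻¹ * ∑ v : (∀ j, A j),
          if v i = x ∧ ∀ j : {j : Fin r // j < i}, v j = u j then 1 else 0) := by
      intro u
      refine HasSum.mul_left _ (hasSum_sum fun v _ => ?_)
      split_ifs with h
      · simpa using HasSum.prod_fin fun k => hC.2 (g v k)
      · exact hasSum_zero
    have h2 := HasSum.prod_fintype h1
    refine (?_ : _ = (1 : ℝ)) ▸ h2
    rw [← Finset.mul_sum, Finset.sum_comm, inv_mul_eq_one₀, eq_comm]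
    · rw [← sum_ite_eq_card i x]
      refine Finset.sum_congr rfl fun v _ => ?_
      by_cases hv : v i = x
      · have : ∀ u : (∀ j : {j : Fin r // j < i}, A j),
            (∀ j : {j : Fin r // j < i}, v j = u j) ↔ (fun j : {j : Fin r // j < i} => v j) = u :=
          fun u => funext_iff.symm
        simp only [hv, true_and, if_true]
        simp_rw [this]
        simp
      · simp [hv]
    · exact Finset.prod_ne_zero_iff.2 fun j _ => by
        have := hA j
        exact_mod_cast Fintype.card_ne_zero

/-- All terms are nonnegative: keep the outputs that carry the common prefix of `v` and `v'`, and in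
the two likelihoods keep the words `g v` and `g v'` alone. The sum over outputs then factorizes. -/
theorem IsChannel.le_bhattPair_split (hC : C.IsChannel) (i : Fin r) (hA : ∀ j, Nonempty (A j))
    {v v' : ∀ j, A j} (h : ∀ j, j < i → v j = v' j) :
    (∏ j ∈ Finset.univ.erase i, (Fintype.card (A j) : ℝ))⁻¹ *
        ∏ k, C.bhattPair (g v k) (g v' k) ≤
      (Transition.split g C i).bhattPair (v i) (v' i) := by
  set c := (∏ j ∈ Finset.univ.erase i, (Fintype.card (A j) : ℝ))⁻¹ with hc
  have hc0 : 0 ≤ c := inv_nonneg.2 (Finset.prod_nonneg fun j _ => by positivity)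
  have h1 := (HasSum.prod_fin fun k => hC.hasSum_bhattPair (g v k) (g v' k)).mul_left c
  set u : ∀ j : {j : Fin r // j < i}, A j := fun j => v j with hu
  have hterm : ∀ (y : Fin ℓ → C.Out) (v₀ : ∀ j, A j), (∀ j, j < i → v₀ j = v j) →
      c * ∏ k, C.prob (g v₀ k) (y k) ≤ (Transition.split g C i).prob (v₀ i) (y, u) := by
    intro y v₀ hv₀
    rw [split_prob]
    refine mul_le_mul_of_nonneg_left ?_ hc0
    refine le_trans ?_ (Finset.single_le_sum (f := fun w : ∀ j, A j =>
      if w i = v₀ i ∧ ∀ j : {j : Fin r // j < i}, w j = u j then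
        ∏ k, C.prob (g w k) (y k) else 0) (fun w _ => ?_) (Finset.mem_univ v₀))
    · rw [if_pos ⟨rfl, fun j => hv₀ j j.2⟩]
    · split_ifs
      · exact hC.likelihood_nonneg y w
      · exact le_rfl
  have hsplit := hC.split g i hA
  rw [← h1.tsum_eq, bhattPair]
  refine h1.summable.tsum_le_tsum_of_inj (fun y => ((y, u) : (Transition.split g C i).Out))
    (fun y y' hy => congrArg Prod.fst hy) (fun o _ => Real.sqrt_nonneg _) (fun y => ?_)
    (hsplit.summable_sqrt _ _)
  have e : c * ∏ k, √(C.prob (g v k) (y k) * C.prob (g v' k) (y k)) =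
      √((c * ∏ k, C.prob (g v k) (y k)) * (c * ∏ k, C.prob (g v' k) (y k))) := by
    rw [mul_mul_mul_comm, Real.sqrt_mul (by positivity), Real.sqrt_mul_self hc0,
      ← Finset.prod_mul_distrib, Real.sqrt_prod]
    intro k _
    exact mul_nonneg (hC.1 _ _) (hC.1 _ _)
  rw [e]
  refine Real.sqrt_le_sqrt (mul_le_mul (hterm y v fun j _ => rfl)
    (hterm y v' fun j hj => (h j hj).symm) (mul_nonneg hc0 (hC.likelihood_nonneg y v'))
    (hsplit.1 _ _))

/-- The square root is subadditive, and the normalizing factor is at most 1. -/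
theorem sqrt_splitLikelihood_mul_le {F : (∀ j, A j) → ℝ} (hF : ∀ v, 0 ≤ F v) (i : Fin r)
    (hA : ∀ j, Nonempty (A j)) (u : ∀ j : {j : Fin r // j < i}, A j) (x x' : A i) :
    √(splitLikelihood F i u x * splitLikelihood F i u x') ≤ ∑ p : (∀ j, A j) × (∀ j, A j),
      if (p.1 i = x ∧ ∀ j : {j : Fin r // j < i}, p.1 j = u j) ∧
          (p.2 i = x' ∧ ∀ j : {j : Fin r // j < i}, p.2 j = u j) then
        √(F p.1 * F p.2) else 0 := by
  rw [splitLikelihood, splitLikelihood]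
  set c := (∏ j ∈ Finset.univ.erase i, (Fintype.card (A j) : ℝ))⁻¹ with hc
  have hc0 : 0 ≤ c := inv_nonneg.2 (Finset.prod_nonneg fun j _ => by positivity)
  have hc1 : c ≤ 1 := by
    refine inv_le_one_of_one_le₀ ?_
    rw [← Nat.cast_prod]
    have : 0 < ∏ j ∈ Finset.univ.erase i, Fintype.card (A j) :=
      Finset.prod_pos fun j _ => by have := hA j; exact Fintype.card_pos
    exact_mod_cast this
  rw [mul_mul_mul_comm, Real.sqrt_mul (by positivity), Real.sqrt_mul_self hc0, Finset.sum_mul_sum,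
    ← Fintype.sum_prod_type']
  refine (mul_le_of_le_one_left (Real.sqrt_nonneg _) hc1).trans ?_
  refine (Real.sqrt_sum_le _ _ fun p => ?_).trans_eq (Finset.sum_congr rfl fun p _ => ?_)
  · have := hF p.1
    have := hF p.2
    split_ifs <;> positivity
  · rw [ite_zero_mul_ite_zero, apply_ite Real.sqrt, Real.sqrt_zero]

/-- A union bound over all pairs of inputs that agree before `i`; summing over the output factorizes
each term over the coordinates. -/
theorem IsChannel.bhattPair_split_le (hC : C.IsChannel) (i : Fin r) (hA : ∀ j, Nonempty (A j))
    (x x' : A i) :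
    (Transition.split g C i).bhattPair x x' ≤ ∑ p : (∀ j, A j) × (∀ j, A j),
      if p.1 i = x ∧ p.2 i = x' ∧ ∀ j, j < i → p.1 j = p.2 j then
        ∏ k, C.bhattPair (g p.1 k) (g p.2 k) else 0 := by
  have h1 : ∀ u : (∀ j : {j : Fin r // j < i}, A j), HasSum (fun y : Fin ℓ → C.Out =>
      ∑ p : (∀ j, A j) × (∀ j, A j),
        if (p.1 i = x ∧ ∀ j : {j : Fin r // j < i}, p.1 j = u j) ∧
            (p.2 i = x' ∧ ∀ j : {j : Fin r // j < i}, p.2 j = u j) then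
          ∏ k, √(C.prob (g p.1 k) (y k) * C.prob (g p.2 k) (y k)) else 0)
      (∑ p : (∀ j, A j) × (∀ j, A j),
        if (p.1 i = x ∧ ∀ j : {j : Fin r // j < i}, p.1 j = u j) ∧
            (p.2 i = x' ∧ ∀ j : {j : Fin r // j < i}, p.2 j = u j) then
          ∏ k, C.bhattPair (g p.1 k) (g p.2 k) else 0) := by
    intro u
    refine hasSum_sum fun p _ => ?_
    split_ifs
    · exact HasSum.prod_fin
        (f := fun k y => √(C.prob (g p.1 k) y * C.prob (g p.2 k) y))
        fun k => hC.hasSum_bhattPair (g p.1 k) (g p.2 k)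
    · exact hasSum_zero
  have h2 := HasSum.prod_fintype (f := fun o : (Transition.split g C i).Out =>
      ∑ p : (∀ j, A j) × (∀ j, A j),
        if (p.1 i = x ∧ ∀ j : {j : Fin r // j < i}, p.1 j = o.2 j) ∧
            (p.2 i = x' ∧ ∀ j : {j : Fin r // j < i}, p.2 j = o.2 j) then
          ∏ k, √(C.prob (g p.1 k) (o.1 k) * C.prob (g p.2 k) (o.1 k)) else 0) h1
  refine (hasSum_le ?_ ((hC.split g i hA).hasSum_bhattPair x x') h2).trans ?_
  · rintro ⟨y, u⟩
    refine (sqrt_splitLikelihood_mul_le (hC.likelihood_nonneg (g := g) y) i hA u x x').trans_eq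
      (Finset.sum_congr rfl fun p _ => ?_)
    rw [← Finset.prod_mul_distrib, Real.sqrt_prod]
    intro k _
    exact mul_nonneg (hC.1 _ _) (hC.1 _ _)
  · rw [Finset.sum_comm]
    refine Finset.sum_le_sum fun p _ => ?_
    have hprod : 0 ≤ ∏ k, C.bhattPair (g p.1 k) (g p.2 k) :=
      Finset.prod_nonneg fun k _ => C.bhattPair_nonneg _ _
    by_cases hp : p.1 i = x ∧ p.2 i = x' ∧ ∀ j, j < i → p.1 j = p.2 j
    · rw [if_pos hp]
      rw [Finset.sum_eq_single_of_mem (fun j : {j : Fin r // j < i} => p.1 j) (Finset.mem_univ _)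
        fun u _ hu => if_neg fun h => hu (funext fun j => (h.1.2 j).symm), if_pos]
      exact ⟨⟨hp.1, fun j => rfl⟩, hp.2.1, fun j => (hp.2.2 j j.2).symm⟩
    · rw [if_neg hp]
      refine le_of_eq (Finset.sum_eq_zero fun u _ => if_neg fun h => hp ?_)
      exact ⟨h.1.1, h.2.1, fun j hj => (h.1.2 ⟨j, hj⟩).trans (h.2.2 ⟨j, hj⟩).symm⟩

/-- The chain rule of mutual information for a bijective mapping. -/
theorem IsChannel.sum_info_split [Fintype X] (hC : C.IsChannel) (hA : ∀ j, Nonempty (A j))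
    (hg : Function.Bijective g) : ∑ i, (Transition.split g C i).info = ℓ * C.info := by
  classical
  -- An empty alphabet forces `ℓ = 0`; by bijectivity all `A i` are then singletons, and both sides
  -- vanish.
  rcases isEmpty_or_nonempty X with hX | hX
  · have h0 : C.info = 0 := by simp [info]
    have hV : Nonempty (∀ j, A j) := inferInstance
    obtain ⟨v⟩ := hV
    have : ℓ = 0 := by
      by_contra hℓ
      exact hX.false (g v ⟨0, Nat.pos_of_ne_zero hℓ⟩)
    subst this
    have hsub : Subsingleton (∀ j, A j) := hg.1.subsingleton
    have : ∀ i, (Transition.split g C i).info = 0 := by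
      intro i
      have hs := hC.split g i hA
      have hAi : Subsingleton (A i) := ⟨fun a b => by
        have := congrFun (hsub.elim (Function.update v i a) (Function.update v i b)) i
        simpa using this⟩
      have h1 := hs.info_le
      have h2 : Fintype.card (A i) = 1 :=
        le_antisymm (Fintype.card_le_one_iff_subsingleton.2 hAi) Fintype.card_pos
      rw [h2] at h1
      exact le_antisymm (by simpa using h1) hs.info_nonneg
    simp [this]
  have h1 : ∀ y : Fin ℓ → C.Out,
      ∑ i, ∑ u, infoDensity (fun x => (Transition.split g C i).prob x (y, u)) =
      ∑ k', ∏ k, if k = k' then infoDensity (fun x => C.prob x (y k))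
        else (Fintype.card X : ℝ)⁻¹ * ∑ x, C.prob x (y k) := by
    intro y
    rw [← infoDensity_prod (a := fun k x => C.prob x (y k)) fun k x => hC.1 x (y k)]
    exact (sum_infoDensity_splitLikelihood (hC.likelihood_nonneg (g := g) y)).trans
      (infoDensity_comp_equiv (Equiv.ofBijective g hg) fun x => ∏ k, C.prob (x k) (y k))
  have h2 : HasSum (fun y : Fin ℓ → C.Out =>
      ∑ k', ∏ k, if k = k' then infoDensity (fun x => C.prob x (y k))
        else (Fintype.card X : ℝ)⁻¹ * ∑ x, C.prob x (y k)) (ℓ * C.info) := by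
    have : (ℓ * C.info : ℝ) = ∑ k' : Fin ℓ, ∏ k, if k = k' then C.info else 1 := by simp
    rw [this]
    refine hasSum_sum fun k' _ => HasSum.prod_fin
      (f := fun k y => if k = k' then infoDensity (fun x => C.prob x y)
        else (Fintype.card X : ℝ)⁻¹ * ∑ x, C.prob x y) fun k => ?_
    split_ifs
    · exact hC.hasSum_infoDensity
    · exact hC.hasSum_mean
  refine HasSum.unique ?_ h2
  simp_rw [← h1]
  refine hasSum_sum fun i _ => ?_
  have h3 := (hC.split g i hA).hasSum_infoDensity
  have h4 : ∀ u : (∀ j : {j : Fin r // j < i}, A j), Summable fun y : Fin ℓ → C.Out =>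
      infoDensity (fun x => (Transition.split g C i).prob x (y, u)) := fun u =>
    h3.summable.comp_injective (i := fun y : Fin ℓ → C.Out => (y, u))
      fun y y' hy => congrArg Prod.fst hy
  have h5 := HasSum.prod_fintype (f := fun o : (Transition.split g C i).Out =>
    infoDensity fun x => (Transition.split g C i).prob x o) fun u => (h4 u).hasSum
  rw [h3.unique h5]
  exact hasSum_sum fun u _ => (h4 u).hasSum

end Split

end Transition

namespace SymKernel

variable {ℓ b : ℕ} (g : SymKernel ℓ b)

/-! ### Partial distances -/

theorem partialDist_le (i : Fin ℓ) {v v' : Fin ℓ → Symb b} (h : ∀ j, j < i → v j = v' j) :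
    g.partialDist i (v i) (v' i) ≤ hammingDist (g v) (g v') :=
  Nat.sInf_le ⟨v, v', h, rfl, rfl, rfl⟩

theorem exists_partialDist_eq (i : Fin ℓ) (x x' : Symb b) :
    ∃ v v' : Fin ℓ → Symb b, (∀ j, j < i → v j = v' j) ∧ v i = x ∧ v' i = x' ∧
      g.partialDist i x x' = hammingDist (g v) (g v') := by
  have h : {d | ∃ v v' : Fin ℓ → Symb b, (∀ j, j < i → v j = v' j) ∧ v i = x ∧ v' i = x' ∧
      d = hammingDist (g v) (g v')}.Nonempty :=
    ⟨_, fun j => if j < i then x else x, fun j => if j < i then x else x',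
      fun j hj => by simp [hj], by simp, by simp, rfl⟩
  exact Nat.sInf_mem h

theorem partialDistMin_le (i : Fin ℓ) {x x' : Symb b} (h : x ≠ x') :
    g.partialDistMin i ≤ g.partialDist i x x' :=
  Nat.sInf_le ⟨x, x', h, rfl⟩

theorem one_le_partialDist (i : Fin ℓ) {x x' : Symb b} (h : x ≠ x') :
    1 ≤ g.partialDist i x x' := by
  obtain ⟨v, v', -, rfl, rfl, hd⟩ := g.exists_partialDist_eq i x x'
  rw [hd]
  exact hammingDist_pos.2 fun hv => h (congrFun (g.injective hv) i)

theorem one_le_partialDistMin [Nontrivial (Symb b)] (i : Fin ℓ) : 1 ≤ g.partialDistMin i := by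
  have hne : {d | ∃ x x' : Symb b, x ≠ x' ∧ d = g.partialDist i x x'}.Nonempty := by
    obtain ⟨x, x', h⟩ := exists_pair_ne (Symb b)
    exact ⟨_, x, x', h, rfl⟩
  obtain ⟨x, x', h, hd⟩ := Nat.sInf_mem hne
  rw [partialDistMin, hd]
  exact g.one_le_partialDist i h

theorem partialDistMin_le_dim [Nontrivial (Symb b)] (i : Fin ℓ) : g.partialDistMin i ≤ ℓ := by
  obtain ⟨x, x', h⟩ := exists_pair_ne (Symb b)
  obtain ⟨v, v', -, -, -, hd⟩ := g.exists_partialDist_eq i x x'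
  exact (g.partialDistMin_le i h).trans (hd ▸ hammingDist_le_card_fintype.trans_eq (by simp))

theorem partialDist_le_max (i : Fin ℓ) (x x' : Symb b) :
    g.partialDist i x x' ≤ g.partialDistMax i :=
  Finset.le_sup (f := fun p : Symb b × Symb b => g.partialDist i p.1 p.2) (Finset.mem_univ (x, x'))

theorem one_le_partialDistMax [Nontrivial (Symb b)] (i : Fin ℓ) : 1 ≤ g.partialDistMax i := by
  obtain ⟨x, x', h⟩ := exists_pair_ne (Symb b)
  exact (g.one_le_partialDist i h).trans (g.partialDist_le_max i x x')

/-! ### Bhattacharyya coefficients of the split channels -/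

/-- The `i`-th split channel under the kernel `g`. -/
def splitAt (C : Transition (Symb b)) (i : Fin ℓ) : Transition (Symb b) :=
  Transition.split (A := fun _ : Fin ℓ => Symb b) g C i

theorem prod_ite_ne_eq_pow (t : ℝ) (x x' : Fin ℓ → Symb b) :
    (∏ k, if x k ≠ x' k then t else 1) = t ^ hammingDist x x' := by
  rw [Finset.prod_ite, Finset.prod_const, Finset.prod_const_one, mul_one]
  rfl

variable {C : Transition (Symb b)}

theorem isChannel_splitAt (hC : C.IsChannel) (i : Fin ℓ) : (g.splitAt C i).IsChannel :=
  hC.split g i fun _ => inferInstance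

/-- In the union bound a pair of words contributes one small factor per differing position, and
there are at least `D_min` of these. The constant collects the number `N` of pairs and the factor `Q
= q(q-1)` between the average `Z` and a single coefficient. -/
theorem exists_bhatt_splitAt_le [Nontrivial (Symb b)] :
    ∃ c : ℝ, 0 ≤ c ∧ ∀ C : Transition (Symb b), C.IsChannel → ∀ i,
      (g.splitAt C i).bhatt ≤ 2 ^ c * C.bhatt ^ g.partialDistMin i := by
  set Q : ℝ := (Fintype.card (Symb b) : ℝ) * ((Fintype.card (Symb b) : ℝ) - 1) with hQ
  have hQ1 : 1 ≤ Q := by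
    have h : (2 : ℝ) ≤ Fintype.card (Symb b) := by
      exact_mod_cast Fintype.one_lt_card (α := Symb b)
    nlinarith
  set N : ℝ := (Fintype.card ((Fin ℓ → Symb b) × (Fin ℓ → Symb b)) : ℝ) with hN
  have hN1 : 1 ≤ N := by
    have : 1 ≤ Fintype.card ((Fin ℓ → Symb b) × (Fin ℓ → Symb b)) := Fintype.card_pos
    rw [hN]; exact_mod_cast this
  have hK : 1 ≤ N * Q ^ ℓ := by nlinarith [one_le_pow₀ (n := ℓ) hQ1]
  refine ⟨Real.logb 2 (N * Q ^ ℓ), Real.logb_nonneg (by norm_num) hK, fun C hC i => ?_⟩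
  rw [Real.rpow_logb (by norm_num) (by norm_num) (by linarith)]
  have hz := C.bhatt_nonneg
  refine Transition.bhatt_le fun x x' hx => ?_
  refine (hC.bhattPair_split_le (g := g) i (fun _ => inferInstance) x x').trans ?_
  have hterm : ∀ p : (Fin ℓ → Symb b) × (Fin ℓ → Symb b),
      (if p.1 i = x ∧ p.2 i = x' ∧ ∀ j, j < i → p.1 j = p.2 j then
        ∏ k, C.bhattPair (g p.1 k) (g p.2 k) else 0) ≤ Q ^ ℓ * C.bhatt ^ g.partialDistMin i := by
    rintro ⟨v, v'⟩
    split_ifs with h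
    · obtain ⟨rfl, rfl, h⟩ := h
      -- Truncation at 1 allows the Hamming distance in the exponent to be lowered to `D_min`.
      set t := min 1 (Q * C.bhatt) with ht
      have ht0 : 0 ≤ t := le_min zero_le_one (by positivity)
      calc ∏ k, C.bhattPair (g v k) (g v' k)
          ≤ ∏ k, if g v k ≠ g v' k then t else 1 := by
            refine Finset.prod_le_prod (fun k _ => C.bhattPair_nonneg _ _) fun k _ => ?_
            split_ifs with hk
            · exact le_min (hC.bhattPair_le_one _ _) (Transition.bhattPair_le_bhatt hk)
            · exact hC.bhattPair_le_one _ _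
        _ = t ^ hammingDist (g v) (g v') := prod_ite_ne_eq_pow _ _ _
        _ ≤ t ^ g.partialDistMin i := pow_le_pow_of_le_one ht0 (min_le_left _ _)
            ((g.partialDistMin_le i hx).trans (g.partialDist_le i h))
        _ ≤ (Q * C.bhatt) ^ g.partialDistMin i := pow_le_pow_left₀ ht0 (min_le_right _ _) _
        _ ≤ Q ^ ℓ * C.bhatt ^ g.partialDistMin i := by
            rw [mul_pow]
            exact mul_le_mul_of_nonneg_right (pow_le_pow_right₀ hQ1 (g.partialDistMin_le_dim i))
              (by positivity)
    · positivity
  refine (Finset.sum_le_sum fun p _ => hterm p).trans_eq ?_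
  rw [Finset.sum_const, nsmul_eq_mul, Finset.card_univ, ← mul_assoc]

/-- The channels all whose Bhattacharyya coefficients are at least `2 ^ (-a)`. -/
def bhattAbove (b : ℕ) (a : ℝ) : Set (Transition (Symb b)) :=
  {C | C.IsChannel ∧ ∀ x x', x ≠ x' → (2 : ℝ) ^ (-a) ≤ C.bhattPair x x'}

/-- One pair of words that attains the partial distance already gives the bound. Which symbol pairs
occur in it is not known, hence a lower bound on every coefficient is propagated rather than one on
the average. -/
theorem exists_splitAt_mem_bhattAbove :
    ∃ c : ℝ, 0 ≤ c ∧ ∀ a : ℝ, 0 ≤ a → ∀ C ∈ bhattAbove b a, ∀ i,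
      g.splitAt C i ∈ bhattAbove b (g.partialDistMax i * a + c) := by
  set N : ℝ := (Fintype.card (Fin ℓ → Symb b) : ℝ) with hN
  have hN1 : 1 ≤ N := by
    have : 1 ≤ Fintype.card (Fin ℓ → Symb b) := Fintype.card_pos
    rw [hN]; exact_mod_cast this
  refine ⟨Real.logb 2 N, Real.logb_nonneg (by norm_num) hN1, fun a ha C hC i =>
    ⟨g.isChannel_splitAt hC.1 i, fun x x' hx => ?_⟩⟩
  obtain ⟨v, v', h, rfl, rfl, hd⟩ := g.exists_partialDist_eq i x x'
  refine le_trans ?_ (hC.1.le_bhattPair_split (g := g) i (fun _ => inferInstance) h)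
  set P : ℝ := ∏ j ∈ Finset.univ.erase i, (Fintype.card (Symb b) : ℝ) with hP
  have hq : (1 : ℝ) ≤ Fintype.card (Symb b) := by
    have : 1 ≤ Fintype.card (Symb b) := Fintype.card_pos
    exact_mod_cast this
  have hP0 : 0 < P := Finset.prod_pos fun _ _ => by linarith
  have hPN : P ≤ N := by
    have e : N = Fintype.card (Symb b) * P := by
      rw [hP, Finset.mul_prod_erase _ (fun _ => (Fintype.card (Symb b) : ℝ)) (Finset.mem_univ i), hN,
        Fintype.card_fun]
      simp
    rw [e]; nlinarith
  have ht0 : (0 : ℝ) < 2 ^ (-a) := by positivity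
  have ht1 : (2 : ℝ) ^ (-a) ≤ 1 := Real.rpow_le_one_of_one_le_of_nonpos (by norm_num) (by linarith)
  rw [neg_add, Real.rpow_add (by norm_num), Real.rpow_neg (by norm_num) (Real.logb 2 N),
    Real.rpow_logb (by norm_num) (by norm_num) (by linarith), mul_comm]
  refine mul_le_mul (inv_anti₀ hP0 hPN) ?_ (by positivity) (by positivity)
  calc (2 : ℝ) ^ (-(g.partialDistMax i * a)) = (2 ^ (-a)) ^ g.partialDistMax i := by
        rw [← Real.rpow_natCast, ← Real.rpow_mul (by norm_num)]
        congr 1; ring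
    _ ≤ (2 ^ (-a)) ^ hammingDist (g v) (g v') :=
        pow_le_pow_of_le_one ht0.le ht1 (hd ▸ g.partialDist_le_max i _ _)
    _ = ∏ k, if g v k ≠ g v' k then (2 : ℝ) ^ (-a) else 1 := (prod_ite_ne_eq_pow _ _ _).symm
    _ ≤ _ := by
        refine Finset.prod_le_prod (fun k _ => by split_ifs <;> positivity) fun k _ => ?_
        split_ifs with hk
        · exact hC.2 _ _ hk
        · rw [not_not.1 hk, hC.1.bhattPair_self]

/-! ### The tree process of a single kernel -/

theorem sum_uniform_weight [NeZero ℓ] : ∑ _i : Fin ℓ, (ℓ : ℝ)⁻¹ = 1 := by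
  simp [NeZero.ne ℓ]

theorem lowerExponent_eq : g.lowerExponent =
    ∑ i, (ℓ : ℝ)⁻¹ * Real.logb ℓ (g.partialDistMin i) := Finset.mul_sum _ _ _

theorem upperExponent_eq : g.upperExponent =
    ∑ i, (ℓ : ℝ)⁻¹ * Real.logb ℓ (g.partialDistMax i) := Finset.mul_sum _ _ _

/-- If every distance were 1, all logarithms would vanish. Such an index provides the squaring
branch that drives the contraction. -/
theorem exists_two_le_partialDistMin [Nontrivial (Symb b)] (h : 0 < g.lowerExponent) :
    ∃ i, 2 ≤ g.partialDistMin i := by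
  by_contra! hcon
  have : ∀ i, g.partialDistMin i = 1 := fun i => by
    have := g.one_le_partialDistMin i
    have := hcon i
    omega
  simp [lowerExponent, this] at h

theorem logb_card_symb (b : ℕ) : Real.logb 2 (Fintype.card (Symb b)) = b := by
  simp [Real.logb_pow]

section Normalized

variable [NeZero ℓ]

theorem sum_info_splitAt_div (hC : C.IsChannel) :
    ∑ i, (ℓ : ℝ)⁻¹ * ((g.splitAt C i).info / b) = C.info / b := by
  have hℓ : (ℓ : ℝ) ≠ 0 := by exact_mod_cast NeZero.ne ℓ
  rw [← Finset.mul_sum, ← Finset.sum_div,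
    show ∑ i, (g.splitAt C i).info = ℓ * C.info from
      hC.sum_info_split (g := g) (fun _ => inferInstance) g.bijective]
  field_simp

/-- The chance of an event in generation `n` of the tree that grows from `C`. -/
def treeChance (n : ℕ) (A : Set (Transition (Symb b))) (C : Transition (Symb b)) : ℝ :=
  chance (fun _ : Fin ℓ => (ℓ : ℝ)⁻¹) g.splitAt n A C

theorem tendsto_treeChance_Ioo (hpol : g.IsPolarizing) (hC : C.IsChannel) {δ : ℝ} (hδ : 0 < δ)
    (hδ' : δ < 1 / 2) :
    Tendsto (fun n => g.treeChance n {C | C.info / b ∈ Set.Ioo δ (1 - δ)} C) atTop (𝓝 0) := by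
  refine (hpol C hC δ hδ hδ').congr fun n => ?_
  exact g.measureReal_treeChannel C n {C | C.info / b ∈ Set.Ioo δ (1 - δ)}

variable [Nontrivial (Symb b)]

theorem pos_of_nontrivial_symb : (0 : ℝ) < b := by
  rcases Nat.eq_zero_or_pos b with rfl | h
  · exact absurd ‹Nontrivial (Symb 0)› (not_nontrivial _)
  · exact_mod_cast h

theorem info_div_mem_Icc (hC : C.IsChannel) : C.info / b ∈ Set.Icc (0 : ℝ) 1 := by
  have hb : (0 : ℝ) < b := pos_of_nontrivial_symb
  refine ⟨div_nonneg hC.info_nonneg hb.le, (div_le_one hb).2 ?_⟩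
  exact hC.info_le.trans_eq (logb_card_symb b)

/-- Channels of almost maximal information have a small Bhattacharyya parameter. -/
theorem exists_bhatt_le_of_info {ε : ℝ} (hε : 0 < ε) :
    ∃ δ > 0, ∀ C : Transition (Symb b), C.IsChannel → 1 - δ ≤ C.info / b → C.bhatt ≤ ε := by
  have hb : (0 : ℝ) < b := pos_of_nontrivial_symb
  set q : ℝ := (Fintype.card (Symb b) : ℝ) with hq
  have hq0 : 0 < q := Nat.cast_pos.2 (Fintype.card_pos (α := Symb b))
  -- With `λ = ε / q` this `δ` makes both terms of the estimate at most `ε`, hence also their half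
  -- sum.
  refine ⟨ε ^ 2 / (q ^ 2 * b), by positivity, fun C hC h => Transition.bhatt_le fun x x' hx => ?_⟩
  have h1 := hC.bhattPair_le_of_info hx (lam := ε / q) (by positivity)
  rw [logb_card_symb, ← hq] at h1
  have h2 : b - C.info ≤ ε ^ 2 / q ^ 2 := by
    rw [le_div_iff₀ hb, sub_mul, one_mul] at h
    have : ε ^ 2 / (q ^ 2 * b) * b = ε ^ 2 / q ^ 2 := by field_simp
    linarith
  have h3 : (ε / q)⁻¹ * (q * (b - C.info)) ≤ ε := by
    have e : (ε / q)⁻¹ * (q * (b - C.info)) = q ^ 2 / ε * (b - C.info) := by field_simp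
    have e2 : q ^ 2 / ε * (ε ^ 2 / q ^ 2) = ε := by field_simp
    rw [e]
    exact (mul_le_mul_of_nonneg_left h2 (by positivity)).trans_eq e2
  have h4 : ε / q * q = ε := by field_simp
  linarith

/-- Channels of small information have a large Bhattacharyya parameter. -/
theorem exists_lt_bhatt_of_info :
    ∃ δ > 0, ∀ C : Transition (Symb b), C.IsChannel → C.info / b ≤ δ → 1 / 2 < C.bhatt := by
  have hb : (0 : ℝ) < b := pos_of_nontrivial_symb
  set q : ℝ := (Fintype.card (Symb b) : ℝ) with hq
  have hq0 : 0 < q := Nat.cast_pos.2 (Fintype.card_pos (α := Symb b))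
  refine ⟨1 / (4 * q * b), by positivity, fun C hC h => ?_⟩
  have h1 : C.info ≤ 1 / (4 * q) := by
    rw [div_le_iff₀ hb] at h
    exact h.trans_eq (by field_simp)
  have h2 : (3 / 4 : ℝ) ≤ C.bhatt := Transition.le_bhatt fun x x' hx => by
    have h3 := hC.le_bhattPair_of_info hx
    have h4 : q * (Real.log 2 * C.info) ≤ q * (1 * (1 / (4 * q))) := by
      refine mul_le_mul_of_nonneg_left (mul_le_mul ?_ h1 hC.info_nonneg zero_le_one) hq0.le
      linarith [Real.log_two_lt_d9]
    have e : q * (1 * (1 / (4 * q))) = 1 / 4 := by field_simp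
    linarith
  linarith

/-- Markov's inequality for the nonnegative martingale `I/b`. -/
theorem mul_treeChance_le (hC : C.IsChannel) {δ : ℝ} (n : ℕ) :
    (1 - δ) * g.treeChance n {C | 1 - δ ≤ C.info / b} C ≤ C.info / b := by
  have hw : ∀ _i : Fin ℓ, 0 ≤ (ℓ : ℝ)⁻¹ := fun _ => by positivity
  have hG : ∀ C ∈ {C : Transition (Symb b) | C.IsChannel}, ∀ i,
      g.splitAt C i ∈ {C : Transition (Symb b) | C.IsChannel} :=
    fun C hC i => g.isChannel_splitAt hC i
  rw [← iterMean_eq_self hG (f := fun C => C.info / b)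
    (fun C hC => g.sum_info_splitAt_div hC) n hC, treeChance, chance, ← iterMean_const_mul]
  refine iterMean_mono hw hG (fun C hC => ?_) n hC
  have h0 := (info_div_mem_Icc hC).1
  by_cases h : C ∈ {C : Transition (Symb b) | 1 - δ ≤ C.info / b}
  · rw [Set.indicator_of_mem h, Pi.one_apply, mul_one]
    exact h
  · rw [Set.indicator_of_notMem h, mul_zero]
    exact h0

/-- As `I/b ≤ 1`, it is bounded by `δ` plus the indicators of the middle and the top range;
averaging keeps the left side fixed by the martingale property. -/
theorem info_div_le_treeChance (hC : C.IsChannel) {δ : ℝ} (hδ : 0 < δ) (n : ℕ) :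
    C.info / b ≤ δ + g.treeChance n {C | C.info / b ∈ Set.Ioo δ (1 - δ)} C +
      g.treeChance n {C | 1 - δ ≤ C.info / b} C := by
  have hw : ∀ _i : Fin ℓ, 0 ≤ (ℓ : ℝ)⁻¹ := fun _ => by positivity
  have hG : ∀ C ∈ {C : Transition (Symb b) | C.IsChannel}, ∀ i,
      g.splitAt C i ∈ {C : Transition (Symb b) | C.IsChannel} :=
    fun C hC i => g.isChannel_splitAt hC i
  have key : C.info / b ≤ iterMean (fun _ : Fin ℓ => (ℓ : ℝ)⁻¹) g.splitAt n (fun C' =>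
      δ + {C : Transition (Symb b) | C.info / b ∈ Set.Ioo δ (1 - δ)}.indicator 1 C' +
        {C : Transition (Symb b) | 1 - δ ≤ C.info / b}.indicator 1 C') C := ?_
  · rwa [iterMean_add_fun, iterMean_add_fun, iterMean_const sum_uniform_weight] at key
  refine (iterMean_eq_self hG (f := fun C => C.info / b)
    (fun C hC => g.sum_info_splitAt_div hC) n hC).symm.trans_le ?_
  refine iterMean_mono hw hG (fun C hC => ?_) n hC
  obtain ⟨h0, h1⟩ := info_div_mem_Icc hC
  by_cases h2 : C ∈ {C : Transition (Symb b) | 1 - δ ≤ C.info / b}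
  · have h3 : 0 ≤ {C : Transition (Symb b) | C.info / b ∈ Set.Ioo δ (1 - δ)}.indicator
      (1 : Transition (Symb b) → ℝ) C := Set.indicator_nonneg (fun _ _ => zero_le_one) C
    rw [Set.indicator_of_mem h2, Pi.one_apply]
    linarith
  · rw [Set.indicator_of_notMem h2]
    by_cases h3 : C ∈ {C : Transition (Symb b) | C.info / b ∈ Set.Ioo δ (1 - δ)}
    · rw [Set.indicator_of_mem h3, Pi.one_apply]
      linarith
    · rw [Set.indicator_of_notMem h3]
      have h4 : C.info / b ≤ δ := by
        by_contra hcon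
        exact h3 ⟨not_le.1 hcon, not_le.1 h2⟩
      linarith

/-- The rate of polarization towards perfect channels, for a polarizing kernel. -/
theorem tendsto_treeChance_bhatt_le (hℓ : 1 < ℓ) (hpol : g.IsPolarizing) (hC : C.IsChannel)
    {β : ℝ} (hβ0 : 0 ≤ β) (hβ : β < g.lowerExponent) (T : ℕ) :
    Tendsto (fun n : ℕ => g.treeChance n
      {C | C.bhatt ≤ (2 : ℝ) ^ (-((ℓ : ℝ) ^ (β * ((T : ℝ) + n))))} C) atTop (𝓝 (C.info / b)) := by
  have hw : ∀ _i : Fin ℓ, 0 ≤ (ℓ : ℝ)⁻¹ := fun _ => by positivity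
  have hG : ∀ C ∈ {C : Transition (Symb b) | C.IsChannel}, ∀ i,
      g.splitAt C i ∈ {C : Transition (Symb b) | C.IsChannel} :=
    fun C hC i => g.isChannel_splitAt hC i
  have hL : (1 : ℝ) < ℓ := by exact_mod_cast hℓ
  have hJ := info_div_mem_Icc hC
  rw [tendsto_order]
  constructor
  · intro x hx
    set ε := C.info / b - x with hε
    have hε0 : 0 < ε := by linarith
    obtain ⟨c, hc, hstep⟩ := g.exists_bhatt_splitAt_le
    obtain ⟨i₀, hi₀⟩ := g.exists_two_le_partialDistMin (hβ0.trans_lt hβ)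
    obtain ⟨ε', hε', hfast⟩ := eventually_chance_lt_le hw sum_uniform_weight hG
      (z := Transition.bhatt) (fun C _ => C.bhatt_nonneg) hc (D := g.partialDistMin)
      g.one_le_partialDistMin (fun C hC i => hstep C hC i) (i₀ := i₀) (by positivity) hi₀ hL hβ0
      (g.lowerExponent_eq ▸ hβ) (by positivity : 0 < ε / 4)
    obtain ⟨δ', hδ', hinfo⟩ := exists_bhatt_le_of_info (b := b) hε'
    set δ := min δ' (min (ε / 4) (1 / 4)) with hδ
    have hδ0 : 0 < δ := by positivity
    have hδ1 : δ ≤ δ' := min_le_left _ _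
    have hδ2 : δ ≤ ε / 4 := (min_le_right _ _).trans (min_le_left _ _)
    have hδ3 : δ ≤ 1 / 4 := (min_le_right _ _).trans (min_le_right _ _)
    -- After `m` steps hardly any channel is left in the middle, so by the martingale property the
    -- top range has chance at least `I/b - ε/2`. The fast decay from there costs another `ε/4`.
    obtain ⟨m, hm⟩ := ((g.tendsto_treeChance_Ioo hpol hC hδ0 (by linarith)).eventually
      (ge_mem_nhds (by positivity : 0 < ε / 4))).exists
    have h1 := g.info_div_le_treeChance hC hδ0 m
    -- The `m` waiting steps are added to the shift, because the target exponent counts all steps.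
    have hev := (hfast (T + m)).filter_mono (tendsto_sub_atTop_nat m)
    filter_upwards [eventually_ge_atTop m, hev] with n hn hn'
    obtain ⟨j, rfl⟩ := Nat.exists_eq_add_of_le hn
    set A := {C : Transition (Symb b) | C.bhatt ≤ (2 : ℝ) ^ (-((ℓ : ℝ) ^ (β * (T + (m + j : ℕ)))))}
      with hA
    have h2 := chance_add_le hw sum_uniform_weight hG m j (A := Aᶜ)
      (B := {C | 1 - δ ≤ C.info / b}) (c := ε / 4) (by positivity) (fun C hC hCB => by
        have h3 := hn' C hC (hinfo C hC (le_trans (by linarith) hCB))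
        have e : Aᶜ = {C : Transition (Symb b) |
            (2 : ℝ) ^ (-((ℓ : ℝ) ^ (β * ((T : ℝ) + m + j)))) < C.bhatt} := by
          ext C
          simp [hA, add_assoc]
        rw [e]
        simpa using h3) hC
    have h3 := chance_compl (step := g.splitAt) (sum_uniform_weight (ℓ := ℓ)) (m + j) A C
    have h4 := chance_compl (step := g.splitAt) (sum_uniform_weight (ℓ := ℓ)) m
      {C : Transition (Symb b) | 1 - δ ≤ C.info / b} C
    change x < chance _ _ _ A C
    change _ ≤ δ + _ + chance _ _ _ _ C at h1
    linarith
  · intro x hx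
    set ε := x - C.info / b with hε
    have hε0 : 0 < ε := by linarith
    obtain ⟨δ', hδ', hinfo⟩ := exists_lt_bhatt_of_info (b := b)
    set δ := min δ' (min (ε / 8) (1 / 4)) with hδ
    have hδ0 : 0 < δ := by positivity
    have hδ1 : δ ≤ δ' := min_le_left _ _
    have hδ2 : δ ≤ ε / 8 := (min_le_right _ _).trans (min_le_left _ _)
    have hδ3 : δ ≤ 1 / 4 := (min_le_right _ _).trans (min_le_right _ _)
    filter_upwards [(g.tendsto_treeChance_Ioo hpol hC hδ0 (by linarith)).eventually
      (ge_mem_nhds (by positivity : 0 < ε / 4))] with n hn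
    have h1 := g.mul_treeChance_le hC (δ := δ) n
    have h2 : g.treeChance n {C | C.bhatt ≤ (2 : ℝ) ^ (-((ℓ : ℝ) ^ (β * ((T : ℝ) + n))))} C ≤
        g.treeChance n {C | C.info / b ∈ Set.Ioo δ (1 - δ)} C +
          g.treeChance n {C | 1 - δ ≤ C.info / b} C := by
      refine chance_le_add hw hG (fun C hC hCA => ?_) n hC
      -- The target exponent is at least 1 because `β ≥ 0`; so `Z ≤ 1/2`, which excludes information
      -- near 0.
      have hle : C.bhatt ≤ 1 / 2 := by
        refine le_trans hCA ?_
        have h3 : (1 : ℝ) ≤ (ℓ : ℝ) ^ (β * ((T : ℝ) + n)) :=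
          Real.one_le_rpow hL.le (by positivity)
        calc (2 : ℝ) ^ (-((ℓ : ℝ) ^ (β * ((T : ℝ) + n)))) ≤ 2 ^ (-1 : ℝ) :=
              Real.rpow_le_rpow_of_exponent_le (by norm_num) (by linarith)
          _ = 1 / 2 := by rw [Real.rpow_neg_one]; norm_num
      have hδlt : δ < C.info / b := by
        by_contra hcon
        have := hinfo C hC ((not_lt.1 hcon).trans hδ1)
        linarith
      rcases lt_or_ge (C.info / b) (1 - δ) with h | h
      · exact Or.inl ⟨hδlt, h⟩
      · exact Or.inr h
    have h5 : g.treeChance n {C | 1 - δ ≤ C.info / b} C ≤ C.info / b + 2 * δ := by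
      have h6 : g.treeChance n {C | 1 - δ ≤ C.info / b} C ≤ C.info / b / (1 - δ) := by
        rw [le_div_iff₀ (by linarith)]; linarith
      refine h6.trans ?_
      rw [div_le_iff₀ (by linarith)]
      nlinarith [hJ.1, hJ.2]
    linarith

/-- No branch of the tree converges faster than the upper bound on the exponent allows. -/
theorem tendsto_treeChance_le_bhatt (hℓ : 1 < ℓ) (hC : C.IsChannel)
    (hpos : ∀ x x', x ≠ x' → 0 < C.bhattPair x x') {β : ℝ} (hβ : g.upperExponent < β) (T : ℕ) :
    Tendsto (fun n : ℕ => g.treeChance n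
      {C | (2 : ℝ) ^ (-((ℓ : ℝ) ^ (β * ((T : ℝ) + n)))) ≤ C.bhatt} C) atTop (𝓝 1) := by
  have hw : ∀ _i : Fin ℓ, 0 ≤ (ℓ : ℝ)⁻¹ := fun _ => by positivity
  have hG : ∀ C ∈ {C : Transition (Symb b) | C.IsChannel}, ∀ i,
      g.splitAt C i ∈ {C : Transition (Symb b) | C.IsChannel} :=
    fun C hC i => g.isChannel_splitAt hC i
  have hL : (1 : ℝ) < ℓ := by exact_mod_cast hℓ
  obtain ⟨c, hc, hstep⟩ := g.exists_splitAt_mem_bhattAbove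
  -- Finitely many positive coefficients have a common lower bound `2^(-a)`; the sum of the absolute
  -- logarithms is a crude choice of `a`.
  obtain ⟨a, ha, haC⟩ : ∃ a : ℝ, 0 ≤ a ∧ C ∈ bhattAbove b a := by
    refine ⟨∑ p : Symb b × Symb b, |Real.logb 2 (C.bhattPair p.1 p.2)|,
      Finset.sum_nonneg fun _ _ => abs_nonneg _, hC, fun x x' hx => ?_⟩
    rw [← Real.le_logb_iff_rpow_le (by norm_num) (hpos x x' hx)]
    have h1 := Finset.single_le_sum
      (f := fun p : Symb b × Symb b => |Real.logb 2 (C.bhattPair p.1 p.2)|)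
      (fun _ _ => abs_nonneg _) (Finset.mem_univ (x, x'))
    have h2 := neg_abs_le (Real.logb 2 (C.bhattPair x x'))
    dsimp only at h1
    linarith
  have hlim := tendsto_chance_compl_of_bounded hw sum_uniform_weight g.one_le_partialDistMax hc
    (Q := bhattAbove b) (fun a a' h C hC => ⟨hC.1, fun x x' hx =>
      (Real.rpow_le_rpow_of_exponent_le (by norm_num) (by linarith)).trans (hC.2 x x' hx)⟩)
    (fun a ha C hC i => hstep a ha C hC i) hL (g.upperExponent_eq ▸ hβ) (T := T) ha haC
  have hlow := hlim.const_sub 1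
  rw [sub_zero] at hlow
  refine tendsto_of_tendsto_of_tendsto_of_le_of_le hlow tendsto_const_nhds (fun n => ?_)
    fun n => chance_le_one hw sum_uniform_weight n _ C
  dsimp only
  rw [sub_le_iff_le_add', ← chance_compl (step := g.splitAt) (sum_uniform_weight (ℓ := ℓ)) n
    (bhattAbove b ((ℓ : ℝ) ^ (β * ((T : ℝ) + n)))) C, add_comm]
  refine (add_le_add_iff_left _).2 (chance_mono hw hG (fun C _ hCA => ?_) n hC)
  exact Transition.le_bhatt hCA.2

end Normalized

end SymKernel

/-! ### The word map of a code decomposition is a bijection. -/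

namespace CodeDecomposition

variable {ℓ r : ℕ} {m : Fin r → ℕ} (D : CodeDecomposition ℓ m)

theorem T_succ_subset (i : Fin r) (v : ∀ j, Symb (m j)) : D.T i.succ v ⊆ D.T i.castSucc v := by
  rw [← D.cover i v]
  refine fun x hx => Finset.mem_biUnion.2 ⟨v i, Finset.mem_univ _, ?_⟩
  rwa [Function.update_eq_self]

theorem kernel_mem (i : Fin (r + 1)) (v : ∀ j, Symb (m j)) : D.kernel v ∈ D.T i v := by
  induction i using Fin.reverseInduction with
  | last =>
    have h : D.T (Fin.last r) v = {D.kernel v} :=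
      (Finset.card_eq_one.mp (D.last v)).choose_spec
    rw [h]
    exact Finset.mem_singleton_self _
  | cast i ih => exact D.T_succ_subset i v ih

/-- At the first index where the labels differ they select disjoint parts of the same sub-code, and
the final words stay in these parts. -/
theorem kernel_injective : Function.Injective D.kernel := by
  intro v v' hvv'
  by_contra hne
  obtain ⟨j, hj⟩ := Function.ne_iff.1 hne
  obtain ⟨i, hi, hmin⟩ := WellFounded.has_min (wellFounded_lt (α := Fin r)) {j | v j ≠ v' j} ⟨j, hj⟩
  have heq : D.T i.succ (Function.update v i (v' i)) = D.T i.succ v' := by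
    refine D.congr _ _ _ fun j hj => ?_
    rcases (Fin.castSucc_lt_succ_iff.1 hj).eq_or_lt with rfl | h
    · simp
    · rw [Function.update_of_ne h.ne]
      by_contra hcon
      exact hmin j hcon h
  have hdisj := D.disjoint i v (v i) (v' i) hi
  rw [Function.update_eq_self, heq] at hdisj
  exact Finset.disjoint_left.1 hdisj (D.kernel_mem _ v) (hvv' ▸ D.kernel_mem _ v')

theorem kernel_bijective (hm : ∑ i, m i = ℓ) : Function.Bijective D.kernel := by
  refine (Fintype.bijective_iff_injective_and_card _).2 ⟨D.kernel_injective, ?_⟩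
  rw [Fintype.card_pi]
  simp [Finset.prod_pow_eq_pow_sum, hm]

end CodeDecomposition

theorem Transition.bhattPair_comm {X : Type} (C : Transition X) (x x' : X) :
    C.bhattPair x x' = C.bhattPair x' x := by
  simp only [bhattPair, mul_comm]

/-- Two inputs that differ at most at position `i` already give a positive lower bound. -/
theorem Transition.IsChannel.bhattPair_split_pos {X : Type} {C : Transition X} (hC : C.IsChannel)
    (hpos : ∀ x x', 0 < C.bhattPair x x') {r ℓ : ℕ} {A : Fin r → Type} [∀ j, Fintype (A j)]
    [∀ j, DecidableEq (A j)] (hA : ∀ j, Nonempty (A j)) (g : (∀ j, A j) → Fin ℓ → X) (i : Fin r)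
    (x x' : A i) : 0 < (Transition.split g C i).bhattPair x x' := by
  let v : ∀ j, A j := fun j => (hA j).some
  have h := hC.le_bhattPair_split (g := g) i hA (v := Function.update v i x)
    (v' := Function.update v i x') fun j hj => by
      rw [Function.update_of_ne hj.ne, Function.update_of_ne hj.ne]
  rw [Function.update_self, Function.update_self] at h
  refine lt_of_lt_of_le (mul_pos (inv_pos.2 (Finset.prod_pos fun j _ => ?_))
    (Finset.prod_pos fun k _ => hpos _ _)) h
  have := hA j
  exact Nat.cast_pos.2 Fintype.card_pos

/-! ### The tree process of a mixed kernel. -/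

namespace MixedKernel

variable (K : MixedKernel)

instance (i : K.Glued) : Nontrivial (Symb (K.m i)) := by
  have : Nonempty (Fin (K.m i)) := ⟨⟨0, by have := i.2; omega⟩⟩
  exact Function.nontrivial

theorem one_lt_dim : 1 < K.ℓ := by
  obtain ⟨i, hi⟩ := K.exists_glued
  have h : K.m i ≤ ∑ j, K.m j := Finset.single_le_sum (fun _ _ => Nat.zero_le _) (Finset.mem_univ i)
  have := K.sum_m
  omega

theorem dim_pos : (0 : ℝ) < K.ℓ := by exact_mod_cast zero_lt_one.trans K.one_lt_dim

theorem weight_nonneg (a : Fin K.r × (K.Glued → Fin K.ℓ)) : 0 ≤ K.weight a := by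
  unfold weight; positivity

/-- A function of one coordinate sees only the uniform marginal; the draws for the other auxiliary
kernels sum to 1. -/
theorem sum_weight_mul_glued (i : K.Glued) (f : Fin K.ℓ → ℝ) :
    ∑ j : K.Glued → Fin K.ℓ, (∏ _i : K.Glued, (K.ℓ : ℝ)⁻¹) * f (j i) =
      ∑ k, (K.ℓ : ℝ)⁻¹ * f k := by
  have hℓ := K.dim_pos.ne'
  have h : ∀ j : K.Glued → Fin K.ℓ, (∏ _i : K.Glued, (K.ℓ : ℝ)⁻¹) * f (j i) =
      ∏ i', (K.ℓ : ℝ)⁻¹ * if i' = i then f (j i') else 1 := fun j => by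
    rw [Finset.prod_mul_distrib, Finset.prod_ite_eq' Finset.univ i fun i' => f (j i')]
    simp
  have h2 := Finset.prod_univ_sum (fun _ : K.Glued => (Finset.univ : Finset (Fin K.ℓ)))
    fun i' k => (K.ℓ : ℝ)⁻¹ * if i' = i then f k else 1
  rw [Fintype.piFinset_univ] at h2
  rw [Finset.sum_congr rfl fun j _ => h j, ← h2,
    Finset.prod_eq_single i (fun i' _ hi' => by simp [hi', hℓ]) (by simp)]
  simp

theorem sum_prob_single : ∑ i, (K.m i : ℝ) / K.ℓ = 1 := by
  rw [← Finset.sum_div, ← Nat.cast_sum, K.sum_m, div_self K.dim_pos.ne']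

theorem sum_weight_mul_single (f : Fin K.r → ℝ) :
    ∑ a, K.weight a * f a.1 = ∑ i, (K.m i : ℝ) / K.ℓ * f i := by
  have h := K.sum_weight_mul_glued (Classical.arbitrary _) fun _ => 1
  simp only [mul_one, SymKernel.sum_uniform_weight] at h
  rw [Fintype.sum_prod_type]
  refine Finset.sum_congr rfl fun i _ => ?_
  simp only [weight]
  rw [← Finset.sum_mul, ← Finset.mul_sum, h, mul_one]

theorem sum_weight : ∑ a, K.weight a = 1 := by
  have h := K.sum_weight_mul_single fun _ => 1
  simp only [mul_one] at h
  rw [h, K.sum_prob_single]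

theorem sum_weight_mul_aux (i : K.Glued) (f : Fin K.ℓ → ℝ) :
    ∑ a, K.weight a * f (a.2 i) = ∑ k, (K.ℓ : ℝ)⁻¹ * f k := by
  rw [Fintype.sum_prod_type]
  simp only [weight, mul_assoc]
  simp only [← Finset.mul_sum, ← Finset.sum_mul, K.sum_prob_single, one_mul]
  rw [Finset.mul_sum, K.sum_weight_mul_glued, ← Finset.mul_sum]

/-- Below a glued node the descendants depend only on the draws for its own auxiliary kernel. -/
theorem chance_glued (n : ℕ) (A : Set (Node K)) (i : K.Glued) (C : Transition (Symb (K.m i))) :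
    chance K.weight K.step n A (.glued i C) =
      (K.aux i).treeChance n {C | Node.glued i C ∈ A} C := by
  induction n generalizing C with
  | zero =>
    by_cases h : Node.glued i C ∈ A
    · simp [SymKernel.treeChance, chance, iterMean, h]
    · simp [SymKernel.treeChance, chance, iterMean, h]
  | succ n ih =>
    change ∑ a, K.weight a * chance K.weight K.step n A (.glued i ((K.aux i).splitAt C (a.2 i))) = _
    simp only [ih]
    exact K.sum_weight_mul_aux i fun k =>
      (K.aux i).treeChance n {C | Node.glued i C ∈ A} ((K.aux i).splitAt C k)

/-- The nodes with a one-bit input. -/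
def singles : Set (Node K) := {s | ∃ C, s = .single C}

theorem glued_notMem_singles (i : K.Glued) (C : Transition (Symb (K.m i))) :
    Node.glued i C ∉ K.singles := by
  rintro ⟨C', h⟩
  cases h

/-- The tree process leaves the one-bit channels geometrically fast. -/
theorem exists_chance_singles_le :
    ∃ ρ : ℝ, 0 ≤ ρ ∧ ρ < 1 ∧ ∀ n s, chance K.weight K.step n K.singles s ≤ ρ ^ n := by
  -- `ρ` is the probability of drawing an input that is not glued; it is below 1 because some glued
  -- input has positive weight.
  set ρ : ℝ := ∑ i, (K.m i : ℝ) / K.ℓ * (if 2 ≤ K.m i then 0 else 1) with hρ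
  have hρ0 : 0 ≤ ρ := Finset.sum_nonneg fun i _ => by split_ifs <;> positivity
  have hρ1 : ρ < 1 := by
    rw [← K.sum_prob_single]
    obtain ⟨i, hi⟩ := K.exists_glued
    have hℓ := K.dim_pos
    refine Finset.sum_lt_sum (fun j _ => ?_) ⟨i, Finset.mem_univ i, ?_⟩
    · split_ifs
      · rw [mul_zero]; positivity
      · rw [mul_one]
    · rw [if_pos hi, mul_zero]
      have : 0 < K.m i := by omega
      positivity
  have hglued : ∀ n (i : K.Glued) C, chance K.weight K.step n K.singles (.glued i C) = 0 := by
    intro n i C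
    have h : {C : Transition (Symb (K.m i)) | Node.glued i C ∈ K.singles} = ∅ := by
      ext C
      simpa using K.glued_notMem_singles i C
    rw [chance_glued, h, SymKernel.treeChance, chance, Set.indicator_empty]
    exact iterMean_const SymKernel.sum_uniform_weight 0 n C
  refine ⟨ρ, hρ0, hρ1, fun n => ?_⟩
  induction n with
  | zero => exact fun s => (chance_le_one K.weight_nonneg K.sum_weight 0 _ s).trans_eq (pow_zero _).symm
  | succ n ih =>
    rintro (C | ⟨i, C⟩)
    · change ∑ a, K.weight a * chance K.weight K.step n K.singles (K.splitSingle C a.1) ≤ _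
      rw [K.sum_weight_mul_single fun i => chance K.weight K.step n K.singles (K.splitSingle C i),
        pow_succ', hρ, Finset.sum_mul]
      refine Finset.sum_le_sum fun i _ => ?_
      rw [mul_assoc]
      refine mul_le_mul_of_nonneg_left ?_ (by positivity)
      split_ifs with h
      · rw [splitSingle, dif_pos h, hglued, zero_mul]
      · rw [one_mul]
        exact ih _
    · rw [hglued]
      positivity

/-- If the chances converge at all glued nodes, to a quantity that is preserved in the mean, then
they converge everywhere. -/
theorem tendsto_chance_of_glued {G : Set (Node K)} (hG : ∀ s ∈ G, ∀ a, K.step s a ∈ G)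
    {h : Node K → ℝ} (h01 : ∀ s ∈ G, h s ∈ Set.Icc (0 : ℝ) 1)
    (hmean : ∀ s ∈ G, ∑ a, K.weight a * h (K.step s a) = h s) {A : ℕ → Set (Node K)}
    (hlim : ∀ T i C, Node.glued i C ∈ G → Tendsto
      (fun n => chance K.weight K.step n (A (T + n)) (.glued i C)) atTop (𝓝 (h (.glued i C))))
    {s : Node K} (hs : s ∈ G) :
    Tendsto (fun n => chance K.weight K.step n (A n) s) atTop (𝓝 (h s)) := by
  obtain ⟨ρ, hρ0, hρ1, hsingle⟩ := K.exists_chance_singles_le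
  rw [Metric.tendsto_atTop']
  intro ε hε
  obtain ⟨T, hT⟩ := exists_pow_lt_of_lt_one (half_pos hε) hρ1
  -- At one-bit nodes the chance is replaced by its intended limit, so `f` converges at every node
  -- of `G`. After `T` steps the replacement changes the mean by at most the chance of still being
  -- at a one-bit node, which is below `ε / 2`.
  set f : ℕ → Node K → ℝ := fun n s =>
    open Classical in if s ∈ K.singles then h s else chance K.weight K.step n (A (T + n)) s with hf
  have hfG : ∀ s ∈ G, Tendsto (fun n => f n s) atTop (𝓝 (h s)) := by
    rintro (C | ⟨i, C⟩) hs
    · have : Node.single C ∈ K.singles := ⟨C, rfl⟩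
      simp [hf, this]
    · simpa [hf, K.glued_notMem_singles i C] using hlim T i C hs
  have hclose : ∀ n, ∀ s ∈ G,
      f n s ≤ chance K.weight K.step n (A (T + n)) s + K.singles.indicator 1 s ∧
      chance K.weight K.step n (A (T + n)) s ≤ f n s + K.singles.indicator 1 s := by
    intro n s hs
    have h1 := chance_nonneg (step := K.step) K.weight_nonneg K.sum_weight n (A (T + n)) s
    have h2 := chance_le_one (step := K.step) K.weight_nonneg K.sum_weight n (A (T + n)) s
    obtain ⟨h3, h4⟩ := h01 s hs
    by_cases hss : s ∈ K.singles
    · simp only [hf, hss, if_true, Set.indicator_of_mem, Pi.one_apply]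
      constructor <;> linarith
    · simp [hf, hss]
  have hlimT := iterMean_tendsto (w := K.weight) hG hfG T hs
  rw [iterMean_eq_self hG hmean T hs, Metric.tendsto_atTop] at hlimT
  obtain ⟨N, hN⟩ := hlimT (ε / 2) (half_pos hε)
  refine ⟨T + N, fun n hn => ?_⟩
  obtain ⟨k, rfl⟩ := Nat.exists_eq_add_of_le (show T ≤ n by omega)
  have h1 := hN k (by omega)
  have h2 := hsingle T s
  have h3 := iterMean_mono K.weight_nonneg hG (fun s hs => (hclose k s hs).1) T hs
  have h4 := iterMean_mono K.weight_nonneg hG (fun s hs => (hclose k s hs).2) T hs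
  rw [iterMean_add_fun] at h3 h4
  rw [Real.dist_eq, abs_lt] at h1 ⊢
  rw [chance_add]
  change iterMean K.weight K.step T (K.singles.indicator 1) s ≤ _ at h2
  constructor <;> linarith

/-- The transition at a node is a channel. -/
inductive Node.IsChannel {K : MixedKernel} : Node K → Prop
  | single {C : Transition Bool} (hC : C.IsChannel) : Node.IsChannel (.single C)
  | glued {i : K.Glued} {C : Transition (Symb (K.m i))} (hC : C.IsChannel) :
    Node.IsChannel (.glued i C)

/-- The mutual information at a node, per bit of the input. -/
def Node.normInfo {K : MixedKernel} : Node K → ℝ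
  | .single C => C.info
  | .glued i C => C.info / K.m i

/-- No two inputs of the channel at the node can be told apart with certainty. -/
inductive Node.IsNoisy {K : MixedKernel} : Node K → Prop
  | single {C : Transition Bool} (h : ∀ x x', 0 < C.bhattPair x x') : Node.IsNoisy (.single C)
  | glued {i : K.Glued} {C : Transition (Symb (K.m i))} (h : ∀ x x', 0 < C.bhattPair x x') :
    Node.IsNoisy (.glued i C)

variable {K}

theorem splitSingle_of_not_glued {C : Transition Bool} {i : Fin K.r} (h : ¬ 2 ≤ K.m i) :
    K.splitSingle C i = .single ((Transition.split K.decomposition.kernel C i).relabel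
      fun x _ => x) := dif_neg h

theorem bijective_const_symb {b : ℕ} (hb : b = 1) :
    Function.Bijective fun (x : Bool) (_ : Fin b) => x := by
  subst hb
  exact ⟨fun x y h => congrFun h 0, fun f => ⟨f 0, funext fun k => by rw [Subsingleton.elim k 0]⟩⟩

theorem Node.IsChannel.step {s : Node K} (hs : s.IsChannel) (a : Fin K.r × (K.Glued → Fin K.ℓ)) :
    (K.step s a).IsChannel := by
  cases hs with
  | single hC =>
    have h := hC.split K.decomposition.kernel a.1 fun _ => inferInstance
    change (K.splitSingle _ a.1).IsChannel
    by_cases hi : 2 ≤ K.m a.1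
    · rw [splitSingle, dif_pos hi]
      exact .glued h
    · rw [splitSingle_of_not_glued hi]
      exact .single (h.relabel _)
  | glued hC => exact .glued ((K.aux _).isChannel_splitAt hC _)

theorem Node.IsNoisy.step {s : Node K} (hs : s.IsNoisy) (hs' : s.IsChannel)
    (a : Fin K.r × (K.Glued → Fin K.ℓ)) : (K.step s a).IsNoisy := by
  cases hs with
  | single h =>
    cases hs' with
    | single hC =>
      have h' := hC.bhattPair_split_pos h (fun _ => inferInstance) K.decomposition.kernel a.1
      change (K.splitSingle _ a.1).IsNoisy
      by_cases hi : 2 ≤ K.m a.1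
      · rw [splitSingle, dif_pos hi]
        exact .glued h'
      · rw [splitSingle_of_not_glued hi]
        exact .single fun x x' => h' _ _
  | @glued i _ h =>
    cases hs' with
    | glued hC => exact .glued (hC.bhattPair_split_pos h (fun _ => inferInstance) (K.aux i) (a.2 i))

theorem Node.IsChannel.normInfo_mem_Icc {s : Node K} (hs : s.IsChannel) :
    s.normInfo ∈ Set.Icc (0 : ℝ) 1 := by
  cases hs with
  | single hC => exact ⟨hC.info_nonneg, hC.info_le.trans_eq (by simp)⟩
  | glued hC => exact SymKernel.info_div_mem_Icc hC

theorem normInfo_splitSingle {C : Transition Bool} (hC : C.IsChannel) (i : Fin K.r) :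
    (K.splitSingle C i).normInfo =
      (Transition.split K.decomposition.kernel C i).info / K.m i := by
  by_cases hi : 2 ≤ K.m i
  · rw [splitSingle, dif_pos hi]
    rfl
  · have h1 : K.m i = 1 := by
      have := K.m_pos i
      omega
    have h := hC.split K.decomposition.kernel i fun _ => inferInstance
    rw [splitSingle_of_not_glued hi]
    change Transition.info _ = _
    have hm : (K.m i : ℝ) = 1 := Nat.cast_eq_one.2 h1
    rw [h.info_relabel (bijective_const_symb h1), hm, div_one]

/-- Choosing the input `i` with probability `m i / ℓ` offsets the division by its `m i` bits, so the
chain rule gives a martingale through the change of alphabet as well. -/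
theorem Node.IsChannel.sum_normInfo_step {s : Node K} (hs : s.IsChannel) :
    ∑ a, K.weight a * (K.step s a).normInfo = s.normInfo := by
  have hℓ := K.dim_pos.ne'
  cases hs with
  | @single C hC =>
    change ∑ a, K.weight a * (K.splitSingle C a.1).normInfo = C.info
    rw [K.sum_weight_mul_single fun i => (K.splitSingle C i).normInfo]
    have h : ∀ i, (K.m i : ℝ) / K.ℓ * (K.splitSingle C i).normInfo =
        (K.ℓ : ℝ)⁻¹ * (Transition.split K.decomposition.kernel C i).info := fun i => by
      have hm : (K.m i : ℝ) ≠ 0 := Nat.cast_ne_zero.2 (Nat.one_le_iff_ne_zero.1 (K.m_pos i))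
      rw [normInfo_splitSingle hC]
      field_simp
    rw [Finset.sum_congr rfl fun i _ => h i, ← Finset.mul_sum,
      hC.sum_info_split (fun _ => inferInstance) (K.decomposition.kernel_bijective K.sum_m)]
    field_simp
  | @glued i C hC =>
    change ∑ a, K.weight a * (((K.aux i).splitAt C (a.2 i)).info / K.m i) = C.info / K.m i
    rw [K.sum_weight_mul_aux i fun k => ((K.aux i).splitAt C k).info / K.m i]
    exact (K.aux i).sum_info_splitAt_div hC

/-- A binary alphabet has a single pair of distinct symbols, so here a nonzero average is enough;
for larger alphabets it would not be. -/
theorem bhattPair_pos_of_bhatt_ne_zero {C : Transition Bool} (hC : C.IsChannel) (hZ : C.bhatt ≠ 0)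
    (x x' : Bool) : 0 < C.bhattPair x x' := by
  have h : C.bhattPair true false ≠ 0 := fun h => hZ <| by
    have h' := C.bhattPair_comm false true
    simp [Transition.bhatt, Fintype.sum_prod_type, h, h']
  have hpos := (C.bhattPair_nonneg true false).lt_of_ne' h
  cases x <;> cases x'
  · simp [hC.bhattPair_self]
  · rwa [C.bhattPair_comm]
  · exact hpos
  · simp [hC.bhattPair_self]

end MixedKernel
end

theorem proposition6 (K : MixedKernel) (hpol : ∀ i : K.Glued, (K.aux i).IsPolarizing)
    (C : Transition Bool) (hC : C.IsChannel) (hZ : C.bhatt ≠ 0) :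
    (∀ β : ℝ, 0 ≤ β → β < K.lowerExponent →
      Tendsto (fun n : ℕ => K.prob.real
          {ω | (K.treeChannel C ω n).bhatt ≤ (2 : ℝ) ^ (-((K.ℓ : ℝ) ^ (β * (n : ℝ))))})
        atTop (𝓝 C.info)) ∧
    (∀ β : ℝ, K.upperExponent < β →
      Tendsto (fun n : ℕ => K.prob.real
          {ω | (2 : ℝ) ^ (-((K.ℓ : ℝ) ^ (β * (n : ℝ)))) ≤ (K.treeChannel C ω n).bhatt})
        atTop (𝓝 1)) := by
  constructor
  · intro β hβ0 hβ
    refine Tendsto.congr (fun n => (K.measureReal_treeChannel C n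
      {s | s.bhatt ≤ (2 : ℝ) ^ (-((K.ℓ : ℝ) ^ (β * (n : ℝ))))}).symm) ?_
    -- The limit at a glued node is its normalized information, which is preserved in the mean and
    -- equals `C.info` at the root.
    refine K.tendsto_chance_of_glued (G := {s | s.IsChannel}) (h := MixedKernel.Node.normInfo)
      (A := fun n => {s | s.bhatt ≤ (2 : ℝ) ^ (-((K.ℓ : ℝ) ^ (β * (n : ℝ))))})
      (fun s hs a => MixedKernel.Node.IsChannel.step hs a)
      (fun s hs => MixedKernel.Node.IsChannel.normInfo_mem_Icc hs)
      (fun s hs => MixedKernel.Node.IsChannel.sum_normInfo_step hs)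
      (fun T i C' hC' => ?_) (MixedKernel.Node.IsChannel.single hC)
    cases hC' with
    | glued hC' =>
      have hβi : β < (K.aux i).lowerExponent :=
        hβ.trans_le (Finset.inf'_le (fun i : K.Glued => (K.aux i).lowerExponent) (Finset.mem_univ i))
      refine ((K.aux i).tendsto_treeChance_bhatt_le K.one_lt_dim (hpol i) hC' hβ0 hβi T).congr
        fun n => ?_
      rw [K.chance_glued, Nat.cast_add]
      rfl
  · intro β hβ
    refine Tendsto.congr (fun n => (K.measureReal_treeChannel C n
      {s | (2 : ℝ) ^ (-((K.ℓ : ℝ) ^ (β * (n : ℝ)))) ≤ s.bhatt}).symm) ?_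
    -- Positivity of all pair coefficients is carried along the tree: at glued nodes the converse
    -- bound requires it for every pair, not only on average.
    refine K.tendsto_chance_of_glued (G := {s | s.IsChannel ∧ s.IsNoisy}) (h := fun _ => 1)
      (A := fun n => {s | (2 : ℝ) ^ (-((K.ℓ : ℝ) ^ (β * (n : ℝ)))) ≤ s.bhatt})
      (fun s hs a => ⟨hs.1.step a, hs.2.step hs.1 a⟩)
      (fun s hs => ⟨zero_le_one, le_rfl⟩)
      (fun s hs => by simpa using K.sum_weight)
      (fun T i C' hC' => ?_)
      ⟨.single hC, .single (MixedKernel.bhattPair_pos_of_bhatt_ne_zero hC hZ)⟩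
    obtain ⟨hC', hn⟩ := hC'
    cases hC' with
    | glued hC' =>
      cases hn with
      | glued hn =>
        have hβi : (K.aux i).upperExponent < β := lt_of_le_of_lt
          (Finset.le_sup' (fun i : K.Glued => (K.aux i).upperExponent) (Finset.mem_univ i)) hβ
        refine ((K.aux i).tendsto_treeChance_le_bhatt K.one_lt_dim hC' (fun x x' _ => hn x x')
          hβi T).congr fun n => ?_
        rw [K.chance_glued, Nat.cast_add]
        rfl
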